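/- Let $d\ge 1$ be an integer. For integers $q\ge 2$, $m\geq 1$ and $\beta>0$ put $p=1-e^{-\beta}$, and let $(X_t)_{t\ge 0}$ be the Swendsen--Wang dynamics for the $q$-state Potts model on the nearest-neighbour torus $\mathbb{Z}_m^d=(\mathbb{Z}/m\mathbb{Z})^d$ at inverse temperature $\beta$: given $X_t$, each edge whose two end points have the same colour in $X_t$ is independently declared open with probability $p$, all other edges are closed, and $X_{t+1}$ is obtained by giving to each connected component of the open edges (isolated vertices included) an independent uniform colour in $\{1,\dots,q\}$. Let $\pi$ be its stationary measure, the Potts measure $\pi(\sigma)\propto \exp(\beta\,|\{uv\in E:\sigma(u)=\sigma(v)\}|)$. For $\Delta\subset\mathbb{Z}_m^d$ let $X_t(\Delta)$ and $\pi_\Delta$ be the projections of $X_t$ and $\pi$ onto $\Delta$, and let $\|\mu-\nu\|_{\mathrm{TV}}=\frac12\sum_x|\mu(x)-\nu(x)|$. For $\log^5 n\le m\le n$, a set $\Delta\subset \mathbb{Z}_m^d$ is called sparse if for some integer $L\le (n/\log^7 n)^d$ it can be partitioned into components $A_1,\dots,A_L$ such that each $A_i$ has $\ell^\infty$-diameter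 at most $\log^5 n$ in $\mathbb{Z}_m^d$, and the $\ell^\infty$-distance in $\mathbb{Z}_m^d$ between any distinct $A_i$ and $A_j$ is at least $2d\log^4 n$. Let $\mathcal{S}(m)$ be the family of sparse sets. Theorem. There is a constant $p_0=p_0(d)\in(0,\frac{1}{4ed}]$ such that for every $q\ge2$ and every $\beta>0$ with $p=1-e^{-\beta}<p_0$ the following holds for all sufficiently large $n$ (depending on $d,q,\beta$). Put $p_\star=\frac{1}{\log(1/(4edp))}$. For all integers $m,s,t$ with $\log^5 n\le m\le n$, $(11dp_\star)\log\log n\le s\le \log^{4/3}n$ and $t>0$, there exists a probability distribution $\rho$ on $\mathcal{S}(m)$ such that for every starting state $x_0\in\{1,\dots,q\}^{\mathbb{Z}_m^d}$, $$\left\|\mathbb{P}_{x_0}(X_{t+s}\in\cdot)-\pi\right\|_{\mathrm{TV}}\le \int_{\mathcal{S}(m)}\left\|\mathbb{P}_{x_0}(X_t(\Delta)\in\cdot)-\pi_\Delta\right\|_{\mathrm{TV}}\,d\rho(\Delta)+3n^{-10d}.$$ -/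

import Mathlib

open scoped NNReal ENNReal

noncomputable section

namespace SwendsenWang

/-! ### The lattice torus -/

/-- The vertex set of the `d`-dimensional torus `ℤ_m^d = (ℤ/mℤ)^d`. -/
abbrev Torus (d m : ℕ) : Type := Fin d → ZMod m

/-- The nearest-neighbour graph on `ℤ_m^d` (periodic boundary conditions): distinct `u`, `v` are
adjacent when they differ by a unit vector in one coordinate direction. -/
def torusGraph (d m : ℕ) : SimpleGraph (Torus d m) where
  Adj u v := u ≠ v ∧ ∃ i : Fin d, v = u + Pi.single i 1 ∨ u = v + Pi.single i 1
  symm := ⟨fun _ _ h => ⟨h.1.symm, h.2.imp fun _ hi => hi.symm⟩⟩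
  loopless := ⟨fun _ h => h.1 rfl⟩

/-- The `ℓ^∞`-distance on the torus: the largest cyclic distance between coordinates. -/
def torusDist {d m : ℕ} (u v : Torus d m) : ℕ :=
  Finset.univ.sup fun i : Fin d => (u i - v i).valMinAbs.natAbs

/-! ### The Potts model and the Swendsen-Wang dynamics on a finite graph -/

section Dynamics

variable {V : Type} [Fintype V] {q : ℕ}

open Classical in
/-- `E_m(σ)`: the edges of `G` whose two end points have the same colour under `σ`. -/
def monoEdges (G : SimpleGraph V) (σ : V → Fin q) : Finset (Sym2 V) :=
  Finset.univ.filter fun e => e ∈ G.edgeSet ∧ (e.map σ).IsDiag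

/-- The `q`-state Potts measure at inverse temperature `β`: `π(σ) ∝ exp (β |E_m(σ)|)`. -/
def potts [NeZero q] (G : SimpleGraph V) (β : ℝ≥0) : PMF (V → Fin q) :=
  PMF.normalize (fun σ => ENNReal.ofReal (Real.exp (β * (monoEdges G σ).card)))
    (by
      intro h
      have h0 := ENNReal.tsum_eq_zero.1 h fun _ => 0
      rw [ENNReal.ofReal_eq_zero] at h0
      exact absurd h0 (not_le.2 (Real.exp_pos _)))
    (by
      classical
      rw [tsum_fintype]
      exact ENNReal.sum_ne_top.2 fun _ _ => ENNReal.ofReal_ne_top)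

/-- The edge probability `p = 1 - e^{-β}`. -/
def edgeProb (β : ℝ≥0) : ℝ := 1 - Real.exp (-β)

open Classical in
/-- Bernoulli percolation on a finite set `F` of edges: the random set of open edges that contains
each `e ∈ F` with probability `p = 1 - e^{-β}`, independently over `e`. -/
def percolation (β : ℝ≥0) (F : Finset (Sym2 V)) : PMF (Finset (Sym2 V)) :=
  PMF.ofFinset
    (fun ω => if ω ⊆ F then
      ENNReal.ofReal (edgeProb β ^ ω.card * (1 - edgeProb β) ^ (F.card - ω.card)) else 0)
    F.powerset
    (by
      have hp : 0 ≤ edgeProb β := by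
        have : Real.exp (-(β : ℝ)) ≤ 1 := Real.exp_le_one_iff.2 (neg_nonpos.2 β.2)
        simpa [edgeProb] using this
      have hp' : 0 ≤ 1 - edgeProb β := by
        simp [edgeProb, Real.exp_nonneg]
      rw [Finset.sum_congr rfl fun ω hω => if_pos (Finset.mem_powerset.1 hω),
        ← ENNReal.ofReal_sum_of_nonneg fun ω _ => mul_nonneg (pow_nonneg hp _) (pow_nonneg hp' _),
        Finset.sum_pow_mul_eq_add_pow]
      simp)
    (by
      intro ω hω
      exact if_neg fun h => hω (Finset.mem_powerset.2 h))

/-- The connected components of the subgraph `(V, ω)` of open edges; every isolated vertex is a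
component. -/
abbrev Component (ω : Finset (Sym2 V)) : Type :=
  (SimpleGraph.fromEdgeSet (ω : Set (Sym2 V))).ConnectedComponent

open Classical in
/-- Colour the components of `(V, ω)` independently and uniformly at random. -/
def recolour (q : ℕ) [NeZero q] (ω : Finset (Sym2 V)) : PMF (V → Fin q) :=
  (PMF.uniformOfFintype (Component ω → Fin q)).map fun c v =>
    c (SimpleGraph.connectedComponentMk _ v)

/-- One step of the Swendsen-Wang dynamics from the configuration `σ`: percolate on the
monochromatic edges of `σ`, then recolour the components of the open edges. -/
def step [NeZero q] (G : SimpleGraph V) (β : ℝ≥0) (σ : V → Fin q) : PMF (V → Fin q) :=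
  (percolation β (monoEdges G σ)).bind fun ω => recolour q ω

/-- The law `ℙ_{x₀}(X_t ∈ ·)` of the Swendsen-Wang dynamics at time `t` when `X_0 = x₀`. -/
def law [NeZero q] (G : SimpleGraph V) (β : ℝ≥0) (x₀ : V → Fin q) : ℕ → PMF (V → Fin q)
  | 0 => PMF.pure x₀
  | t + 1 => (law G β x₀ t).bind (step G β)

/-- The projection of a law on configurations to the configurations on `Δ`. -/
def proj (Δ : Finset V) (μ : PMF (V → Fin q)) : PMF (Δ → Fin q) :=
  μ.map fun σ v => σ v

end Dynamics

/-- The total-variation distance of two probability measures on a finite set. -/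
def tv {S : Type} [Fintype S] (μ ν : PMF S) : ℝ :=
  (1 / 2) * ∑ x, |(μ x).toReal - (ν x).toReal|

/-! ### Sparse sets -/

/-- `Δ ⊆ ℤ_m^d` is sparse (relative to `n`): it has a partition into at most `(n / log^7 n)^d`
components, each of diameter at most `log^5 n`, and any two of them at distance at least
`2 d log^4 n`. -/
def IsSparse (n : ℕ) {d m : ℕ} (Δ : Finset (Torus d m)) : Prop :=
  ∃ P : Finpartition Δ,
    (P.parts.card : ℝ) ≤ ((n : ℝ) / Real.log n ^ 7) ^ d ∧
    (∀ A ∈ P.parts, ∀ u ∈ A, ∀ v ∈ A, (torusDist u v : ℝ) ≤ Real.log n ^ 5) ∧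
    (∀ A ∈ P.parts, ∀ B ∈ P.parts, A ≠ B → ∀ u ∈ A, ∀ v ∈ B,
      2 * (d : ℝ) * Real.log n ^ 4 ≤ (torusDist u v : ℝ))

/-- The family `𝒮(m)` of sparse subsets of `ℤ_m^d`. -/
abbrev SparseSet (n d m : ℕ) : Type := {Δ : Finset (Torus d m) // IsSparse n Δ}

instance (n d m : ℕ) [NeZero m] : Fintype (SparseSet n d m) := Fintype.ofFinite _

/-- The constant `p_⋆ = 1 / log (1 / (4 e d p))`. -/
def pStar (d : ℕ) (p : ℝ) : ℝ := 1 / Real.log (1 / (4 * Real.exp 1 * d * p))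

end SwendsenWang

end

noncomputable section

namespace SwendsenWang

set_option linter.unusedSectionVars false

/-! ### Total variation -/

section TotalVariation

variable {S T : Type} [Fintype S] [Fintype T]

/-! The proof traces the dynamics backwards in time. One step can be realised by percolating on all
edges of the torus, independently of the current configuration, and then discarding the open edges
that are not monochromatic (`step_eq_bind`). Once the open set ω is fixed, the new colours on `A`
depend on the old ones only through the open clusters that meet `A`. A vertex of `A` isolated in ω
gets a fresh uniform colour and needs no past at all. Hence only `hull ω A` matters. Iterating over
`s` independent percolations gives a random set, the history of the whole torus. As the Potts
measure is stationary, convexity of total variation bounds the distance at time `t + s` by the mean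
distance at time `t` on the history (`tv_proj_iterate_le`). The law of the history does not involve
the starting state, so it yields ρ.

It remains to see that the history is sparse up to probability `3 n^(-10d)`. An ancestor that keeps
a history through `s` levels starts an open space-time path with at least `s` distinct edges, and
with at least as many edges as the distance the history travels (`exists_pathSets_of_mem_history`).
There are at most `(6d)^M` candidate paths with `M` edges, each open with probability at most `p^M`,
and paths from starting points more than `2M` apart use disjoint edges, so that their bounds
multiply (`percolations_hasOpenPath_le`).

If the history is not sparse, then one of three unlikely events occurs: some path has about `log^2
n` edges, there are too many separated ancestors, or there is a long chain of separated ancestors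
(`isSparse_of_no_chain`, `percolations_not_isSparse_le`). With `k = log n`, the lower bound on `s`
makes each survival cost at most `k^(-11d)`, which beats the entropy of the last two events; the
path length alone handles the first. -/

theorem toReal_bind_apply (μ : PMF S) {T : Type} (K : S → PMF T) (y : T) :
    (μ.bind K y).toReal = ∑ x, (μ x).toReal * (K x y).toReal := by
  rw [PMF.bind_apply, tsum_fintype, ENNReal.toReal_sum]
  · simp
  · intro x _
    exact ENNReal.mul_ne_top (PMF.apply_ne_top _ _) (PMF.apply_ne_top _ _)

theorem sum_toReal (μ : PMF S) : ∑ x, (μ x).toReal = 1 := by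
  rw [← ENNReal.toReal_sum fun x _ => PMF.apply_ne_top _ _, ← tsum_fintype (L := .unconditional _),
    PMF.tsum_coe, ENNReal.toReal_one]

theorem tv_nonneg (μ ν : PMF S) : 0 ≤ tv μ ν := by
  unfold tv
  positivity

theorem tv_le_one (μ ν : PMF S) : tv μ ν ≤ 1 := by
  have h : ∑ x, |(μ x).toReal - (ν x).toReal| ≤ ∑ x, ((μ x).toReal + (ν x).toReal) := by
    refine Finset.sum_le_sum fun x _ => ?_
    rw [abs_le]
    constructor <;> linarith [ENNReal.toReal_nonneg (a := μ x), ENNReal.toReal_nonneg (a := ν x)]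
  rw [Finset.sum_add_distrib, sum_toReal, sum_toReal] at h
  unfold tv
  linarith

/-- Total variation does not increase under a Markov kernel. -/
theorem tv_bind_le (μ ν : PMF S) (K : S → PMF T) : tv (μ.bind K) (ν.bind K) ≤ tv μ ν := by
  unfold tv
  gcongr
  calc ∑ y, |((μ.bind K) y).toReal - ((ν.bind K) y).toReal|
      ≤ ∑ y, ∑ x, |(μ x).toReal - (ν x).toReal| * (K x y).toReal := by
        refine Finset.sum_le_sum fun y _ => ?_
        rw [toReal_bind_apply, toReal_bind_apply, ← Finset.sum_sub_distrib]
        refine (Finset.abs_sum_le_sum_abs _ _).trans (Finset.sum_le_sum fun x _ => ?_)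
        rw [← sub_mul, abs_mul, abs_of_nonneg (ENNReal.toReal_nonneg (a := K x y))]
    _ = ∑ x, |(μ x).toReal - (ν x).toReal| := by
        rw [Finset.sum_comm]
        refine Finset.sum_congr rfl fun x _ => ?_
        rw [← Finset.mul_sum, sum_toReal, mul_one]

/-- Total variation is convex under mixtures. -/
theorem tv_mixture_le (P : PMF T) (μ ν : T → PMF S) :
    tv (P.bind μ) (P.bind ν) ≤ ∑ i, (P i).toReal * tv (μ i) (ν i) := by
  unfold tv
  calc (1 / 2) * ∑ x, |((P.bind μ) x).toReal - ((P.bind ν) x).toReal|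
      ≤ (1 / 2) * ∑ x, ∑ i, (P i).toReal * |(μ i x).toReal - (ν i x).toReal| := by
        gcongr with x
        rw [toReal_bind_apply, toReal_bind_apply, ← Finset.sum_sub_distrib]
        refine (Finset.abs_sum_le_sum_abs _ _).trans (Finset.sum_le_sum fun i _ => ?_)
        rw [← mul_sub, abs_mul, abs_of_nonneg (ENNReal.toReal_nonneg (a := P i))]
    _ = _ := by
        rw [Finset.sum_comm, Finset.mul_sum]
        refine Finset.sum_congr rfl fun i _ => ?_
        rw [← Finset.mul_sum]
        ring

end TotalVariation

section Projection

variable {V : Type} [Fintype V] {q : ℕ} [NeZero q]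

/-- If, under the kernel `K`, the law on `A` depends only on the input on `B`, then the distance on
`A` after a step is at most the distance on `B` before it. -/
theorem tv_proj_bind_le [DecidableEq V] (A B : Finset V) (K : (V → Fin q) → PMF (V → Fin q))
    (hK : ∀ σ σ' : V → Fin q, (∀ v ∈ B, σ v = σ' v) → proj A (K σ) = proj A (K σ'))
    (μ ν : PMF (V → Fin q)) :
    tv (proj A (μ.bind K)) (proj A (ν.bind K)) ≤ tv (proj B μ) (proj B ν) := by
  -- The colour 0 outside `B` is arbitrary: by `hK` it does not affect the law on `A`.
  let ext : (B → Fin q) → V → Fin q := fun τ v => if h : v ∈ B then τ ⟨v, h⟩ else 0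
  have key : ∀ μ : PMF (V → Fin q),
      proj A (μ.bind K) = (proj B μ).bind fun τ => proj A (K (ext τ)) := by
    intro μ
    unfold proj
    rw [PMF.map_bind, PMF.bind_map]
    congr 1
    funext σ
    refine hK _ _ fun v hv => ?_
    simp [ext, hv]
  rw [key, key]
  exact tv_bind_le (proj B μ) (proj B ν) _

theorem tv_le_tv_proj_univ [DecidableEq V] (μ ν : PMF (V → Fin q)) :
    tv μ ν ≤ tv (proj Finset.univ μ) (proj Finset.univ ν) := by
  have key : ∀ μ : PMF (V → Fin q), μ = (proj Finset.univ μ).bind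
      fun τ => PMF.pure fun v => τ ⟨v, Finset.mem_univ v⟩ := by
    intro μ
    unfold proj
    rw [PMF.bind_map]
    exact (PMF.bind_pure μ).symm
  conv_lhs => rw [key μ, key ν]
  exact tv_bind_le (proj Finset.univ μ) (proj Finset.univ ν) _

end Projection

/-! ### Recolouring -/

section Recolouring

variable {V : Type} [Fintype V] {q : ℕ} [NeZero q]

/-- The law of `v ↦ c (f v)` is uniform for a uniform `c` and an injective `f`. -/
theorem map_uniform_comp_injective {α β γ : Type} [Fintype α] [Fintype β] [Fintype γ]
    [DecidableEq α] [DecidableEq β] [Nonempty γ] (f : α → β) (hf : Function.Injective f) :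
    (PMF.uniformOfFintype (β → γ)).map (fun c a => c (f a)) = PMF.uniformOfFintype (α → γ) := by
  classical
  ext g
  rw [PMF.map_apply, tsum_fintype]
  simp only [PMF.uniformOfFintype_apply]
  rw [← Finset.sum_filter, Finset.sum_const, nsmul_eq_mul]
  have hcard : (Finset.univ.filter fun c : β → γ => g = fun a => c (f a)).card
      = Fintype.card γ ^ (Fintype.card β - Fintype.card α) := by
    -- The fibre over `g` is a product: values are prescribed on the range of `f` and free
    -- elsewhere.
    have : (Finset.univ.filter fun c : β → γ => g = fun a => c (f a))
        = Fintype.piFinset fun b => if h : ∃ a, f a = b then {g h.choose} else Finset.univ := by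
      ext c
      simp only [Finset.mem_filter, Finset.mem_univ, true_and, Fintype.mem_piFinset]
      constructor
      · rintro rfl b
        split_ifs with h
        · simp [h.choose_spec]
        · simp
      · intro h
        funext a
        have ha : ∃ a', f a' = f a := ⟨a, rfl⟩
        have := h (f a)
        rw [dif_pos ha, Finset.mem_singleton] at this
        rw [this, hf ha.choose_spec]
    rw [this, Fintype.card_piFinset]
    have h2 : ∀ b, (if h : ∃ a, f a = b then ({g h.choose} : Finset γ) else Finset.univ).card
        = if b ∈ Finset.univ.image f then 1 else Fintype.card γ := by
      intro b
      by_cases h : ∃ a, f a = b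
      · rw [dif_pos h, if_pos (by simpa using h)]; simp
      · rw [dif_neg h, if_neg (by simpa using h)]; simp
    simp_rw [h2]
    rw [Finset.prod_ite]
    simp only [Finset.prod_const_one, Finset.prod_const, one_mul]
    congr 1
    rw [Finset.filter_not, Finset.filter_mem_eq_inter, Finset.univ_inter,
      ← Finset.compl_eq_univ_sdiff, Finset.card_compl, Finset.card_image_of_injective _ hf,
      Finset.card_univ]
  have hle : Fintype.card α ≤ Fintype.card β := Fintype.card_le_of_injective f hf
  have hpos : (Fintype.card γ : ℝ≥0∞) ≠ 0 := by simp [Fintype.card_ne_zero]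
  have htop : (Fintype.card γ : ℝ≥0∞) ≠ ⊤ := ENNReal.natCast_ne_top _
  rw [hcard, Fintype.card_fun, Fintype.card_fun]
  push_cast
  nth_rewrite 2 [← Nat.sub_add_cancel hle]
  rw [pow_add, ENNReal.mul_inv (Or.inl (pow_ne_zero _ hpos)) (Or.inl (ENNReal.pow_ne_top htop)),
    ← mul_assoc, ENNReal.mul_inv_cancel (pow_ne_zero _ hpos) (ENNReal.pow_ne_top htop), one_mul]

/-- The open graph of a set of edges. -/
abbrev openGraph (ω : Finset (Sym2 V)) : SimpleGraph V := SimpleGraph.fromEdgeSet (ω : Set (Sym2 V))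

/-- The set of vertices connected to `v` by open edges. -/
def cluster (ω : Finset (Sym2 V)) (v : V) : Set V := {w | (openGraph ω).Reachable v w}

theorem cluster_nonempty (ω : Finset (Sym2 V)) (v : V) : (cluster ω v).Nonempty :=
  ⟨v, SimpleGraph.Reachable.refl v⟩

theorem cluster_eq {ω : Finset (Sym2 V)} {v w : V} (h : (openGraph ω).Reachable v w) :
    cluster ω v = cluster ω w :=
  Set.ext fun _ => ⟨h.symm.trans, h.trans⟩

/-- Makes the chosen representative a function of the cluster as a set, so that different edge sets
with the same cluster at a vertex select the same representative. -/
theorem nonempty_some_congr {α : Type} {s t : Set α} (hs : s.Nonempty) (ht : t.Nonempty)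
    (h : s = t) : hs.some = ht.some := by
  subst h
  rfl

open Classical in
/-- Recolouring by colouring all vertices uniformly and giving each vertex the colour of the chosen
representative of its cluster. -/
theorem recolour_eq_map (ω : Finset (Sym2 V)) :
    recolour q ω = (PMF.uniformOfFintype (V → Fin q)).map
      fun c v => c (cluster_nonempty ω v).some := by
  classical
  let f : Component ω → V := fun C => Quot.lift (fun v => (cluster_nonempty ω v).some)
    (fun v w h => nonempty_some_congr _ _ (cluster_eq h)) C
  have hf : Function.Injective f := by
    intro C C'
    refine C.ind fun v => C'.ind fun w => ?_
    intro h
    change (cluster_nonempty ω v).some = (cluster_nonempty ω w).some at h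
    have h1 : (openGraph ω).Reachable v _ := (cluster_nonempty ω v).some_mem
    have h2 : (openGraph ω).Reachable w _ := (cluster_nonempty ω w).some_mem
    rw [h] at h1
    exact SimpleGraph.ConnectedComponent.sound (h1.trans h2.symm)
  unfold recolour
  have := map_uniform_comp_injective (γ := Fin q) f hf
  trans PMF.map (fun (c : Component ω → Fin q) v => c (SimpleGraph.connectedComponentMk _ v))
    (PMF.map (fun c a => c (f a)) (PMF.uniformOfFintype (V → Fin q)))
  · congr 1
    convert this.symm
  · rw [PMF.map_comp]
    rfl

/-- Both recolourings are driven by one uniform colouring of the vertices, read off at the same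
representatives. -/
theorem proj_recolour_congr (A : Finset V) (ω ω' : Finset (Sym2 V))
    (h : ∀ v ∈ A, cluster ω v = cluster ω' v) :
    proj A (recolour q ω) = proj A (recolour q ω') := by
  unfold proj
  rw [recolour_eq_map, recolour_eq_map, PMF.map_comp, PMF.map_comp]
  congr 1
  funext c v
  exact congrArg c (nonempty_some_congr _ _ (h v v.2))

theorem mk_mem_monoEdges {G : SimpleGraph V} {σ : V → Fin q} {x y : V} :
    s(x, y) ∈ monoEdges G σ ↔ G.Adj x y ∧ σ x = σ y := by
  simp [monoEdges]

open Classical in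
theorem subset_monoEdges_iff {G : SimpleGraph V} {σ : V → Fin q} {ω : Finset (Sym2 V)}
    (hω : ∀ e ∈ ω, e ∈ G.edgeSet) :
    ω ⊆ monoEdges G σ ↔ ∀ v w, (openGraph ω).Reachable v w → σ v = σ w := by
  constructor
  · rintro h v w ⟨p⟩
    induction p with
    | nil => rfl
    | cons hadj _ ih =>
      refine Eq.trans ?_ ih
      exact (mk_mem_monoEdges.1 (h ((SimpleGraph.fromEdgeSet_adj _).1 hadj).1)).2
  · intro h e he
    induction e with
    | _ x y =>
      have hadj : G.Adj x y := hω _ he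
      refine mk_mem_monoEdges.2 ⟨hadj, h x y (SimpleGraph.Adj.reachable ?_)⟩
      exact (SimpleGraph.fromEdgeSet_adj _).2 ⟨he, hadj.ne⟩

open Classical in
-- If τ is constant on the components, exactly one colouring of the components produces it;
-- otherwise none does.
theorem recolour_apply {G : SimpleGraph V} {ω : Finset (Sym2 V)} (hω : ∀ e ∈ ω, e ∈ G.edgeSet)
    (τ : V → Fin q) :
    recolour q ω τ = if ω ⊆ monoEdges G τ then
      (Fintype.card (Component ω → Fin q) : ℝ≥0∞)⁻¹ else 0 := by
  unfold recolour
  rw [PMF.map_apply]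
  split_ifs with h
  · rw [subset_monoEdges_iff hω] at h
    let c : Component ω → Fin q := fun C => Quot.lift τ h C
    rw [tsum_eq_single c]
    · have hc : τ = fun v => c (SimpleGraph.connectedComponentMk _ v) := rfl
      rw [if_pos hc, PMF.uniformOfFintype_apply]
    · intro c' hc'
      rw [if_neg]
      rintro rfl
      refine hc' (funext fun C => ?_)
      exact C.ind fun v => rfl
  · rw [ENNReal.tsum_eq_zero]
    intro c
    rw [if_neg]
    rintro rfl
    refine h ((subset_monoEdges_iff hω).2 fun v w hvw => ?_)
    exact congrArg c (SimpleGraph.ConnectedComponent.sound hvw)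

end Recolouring

/-! ### Percolation -/

section Percolation

variable {V : Type} [Fintype V]

theorem edgeProb_nonneg (β : ℝ≥0) : 0 ≤ edgeProb β := by
  have : Real.exp (-(β : ℝ)) ≤ 1 := Real.exp_le_one_iff.2 (neg_nonpos.2 β.2)
  unfold edgeProb
  linarith

theorem one_sub_edgeProb (β : ℝ≥0) : 1 - edgeProb β = Real.exp (-β) := by
  unfold edgeProb
  ring

open Classical in
theorem percolation_apply (β : ℝ≥0) (F ω : Finset (Sym2 V)) :
    percolation β F ω = if ω ⊆ F then
      ENNReal.ofReal (edgeProb β ^ ω.card * (1 - edgeProb β) ^ (F.card - ω.card)) else 0 :=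
  rfl

open Classical in
/-- Percolation on a disjoint union is the union of independent percolations. -/
theorem percolation_union (β : ℝ≥0) (A B : Finset (Sym2 V)) (hAB : Disjoint A B) :
    percolation β (A ∪ B) =
      (percolation β A).bind fun a => (percolation β B).map fun b => a ∪ b := by
  ext ω
  rw [PMF.bind_apply, tsum_fintype]
  simp_rw [PMF.map_apply, tsum_fintype]
  have hdecomp : ∀ a b, a ⊆ A → b ⊆ B → ω = a ∪ b → a = ω ∩ A ∧ b = ω ∩ B := by
    rintro a b ha hb rfl
    rw [Finset.disjoint_left] at hAB
    constructor
    · ext x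
      have h1 := @ha x; have h2 := @hb x; have h3 := @hAB x
      simp only [Finset.mem_inter, Finset.mem_union]; tauto
    · ext x
      have h1 := @ha x; have h2 := @hb x; have h3 := @hAB x
      simp only [Finset.mem_inter, Finset.mem_union]; tauto
  -- By disjointness, only the pair `(ω ∩ A, ω ∩ B)` contributes to ω.
  rw [Finset.sum_eq_single (ω ∩ A), Finset.sum_eq_single (ω ∩ B)]
  · have hiff : ω = ω ∩ (A ∪ B) ↔ ω ⊆ A ∪ B := by rw [eq_comm, Finset.inter_eq_left]
    rw [← Finset.inter_union_distrib_left]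
    simp only [percolation_apply, Finset.inter_subset_right, if_true, hiff]
    split_ifs with h
    · have hc : ω.card = (ω ∩ A).card + (ω ∩ B).card := by
        rw [← Finset.card_union_of_disjoint, ← Finset.inter_union_distrib_left,
          Finset.inter_eq_left.2 h]
        exact hAB.mono Finset.inter_subset_right Finset.inter_subset_right
      have h1 : (ω ∩ A).card ≤ A.card := Finset.card_le_card Finset.inter_subset_right
      have h2 : (ω ∩ B).card ≤ B.card := Finset.card_le_card Finset.inter_subset_right
      have hp := edgeProb_nonneg β
      have hp' : 0 ≤ 1 - edgeProb β := by rw [one_sub_edgeProb]; positivity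
      rw [← ENNReal.ofReal_mul (by positivity), Finset.card_union_of_disjoint hAB, hc,
        show A.card + B.card - ((ω ∩ A).card + (ω ∩ B).card)
          = (A.card - (ω ∩ A).card) + (B.card - (ω ∩ B).card) by omega, pow_add, pow_add]
      ring_nf
    · simp
  · intro b _ hb
    rw [percolation_apply]
    split_ifs with h1 h2
    · exact absurd (hdecomp _ _ Finset.inter_subset_right h2 h1).2 hb
    · rfl
    · rfl
  · simp
  · intro a _ ha
    rw [percolation_apply]
    split_ifs with h
    · rw [Finset.sum_eq_zero, mul_zero]
      intro b _
      rw [percolation_apply]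
      split_ifs with h1 h2
      · exact absurd (hdecomp _ _ h h2 h1).1 ha
      · rfl
      · rfl
    · rw [zero_mul]
  · simp

open Classical in
-- Split `F` into `M` and `F \ M`: the second, independent part is erased by the intersection. This
-- is what allows percolation on all edges to replace percolation on the monochromatic ones.
theorem percolation_map_inter (β : ℝ≥0) {F M : Finset (Sym2 V)} (h : M ⊆ F) :
    (percolation β F).map (fun ω => ω ∩ M) = percolation β M := by
  have hd : Disjoint M (F \ M) := Finset.disjoint_sdiff
  rw [← Finset.union_sdiff_of_subset h, percolation_union β M (F \ M) hd, PMF.map_bind]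
  have key : ∀ a ∈ (percolation β M).support,
      PMF.map (fun ω => ω ∩ M) (PMF.map (fun b => a ∪ b) (percolation β (F \ M)))
        = PMF.pure a := by
    intro a ha
    have haM : a ⊆ M := by
      by_contra hne
      rw [PMF.mem_support_iff, percolation_apply, if_neg hne] at ha
      exact ha rfl
    rw [PMF.map_comp]
    ext c
    rw [PMF.map_apply, PMF.pure_apply, tsum_fintype]
    have : ∀ b, (if c = ((fun ω => ω ∩ M) ∘ fun b => a ∪ b) b then percolation β (F \ M) b else 0)
        = if c = a then percolation β (F \ M) b else 0 := by
      intro b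
      by_cases hb : b ⊆ F \ M
      · have : ((fun ω => ω ∩ M) ∘ fun b => a ∪ b) b = a := by
          simp only [Function.comp]
          rw [Finset.union_inter_distrib_right, Finset.inter_eq_left.2 haM,
            Finset.disjoint_iff_inter_eq_empty.1 (hd.symm.mono_left hb), Finset.union_empty]
        rw [this]
      · rw [percolation_apply, if_neg hb]; simp
    trans ∑ b, if c = a then percolation β (F \ M) b else 0
    · refine Finset.sum_congr rfl fun b _ => ?_
      convert this b
    split_ifs
    · rw [← tsum_fintype (L := .unconditional _), PMF.tsum_coe]
    · simp
  ext c
  rw [PMF.bind_apply]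
  conv_rhs => rw [← PMF.bind_pure (percolation β M), PMF.bind_apply]
  refine tsum_congr fun a => ?_
  by_cases ha : a ∈ (percolation β M).support
  · rw [key a ha]
  · rw [PMF.apply_eq_zero_iff _ _ |>.2 ha, zero_mul, zero_mul]

open Classical in
/-- A given set of edges is open with probability at most `p ^ |F|`. -/
theorem percolation_subset_le (β : ℝ≥0) (E F : Finset (Sym2 V)) :
    (percolation β E).toOuterMeasure {ω | F ⊆ ω} ≤ ENNReal.ofReal (edgeProb β) ^ F.card := by
  by_cases h : F ⊆ E
  · have h1 : (percolation β E).toOuterMeasure {ω | F ⊆ ω}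
        = (percolation β F).toOuterMeasure {ω | F ⊆ ω} := by
      rw [← percolation_map_inter β h, PMF.toOuterMeasure_map_apply]
      congr 1
      ext ω
      simp [Finset.subset_inter_iff]
    rw [h1, PMF.toOuterMeasure_apply, tsum_fintype, Finset.sum_eq_single F]
    · rw [Set.indicator_of_mem (by simp), percolation_apply, if_pos subset_rfl]
      simp [ENNReal.ofReal_pow (edgeProb_nonneg β)]
    · intro ω _ hω
      by_cases hF : F ⊆ ω
      · rw [Set.indicator_of_mem (by simpa using hF), percolation_apply, if_neg]
        exact fun h' => hω (h'.antisymm hF)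
      · exact Set.indicator_of_notMem (by simpa using hF) _
    · simp
  · have : (percolation β E).toOuterMeasure {ω | F ⊆ ω} = 0 := by
      rw [PMF.toOuterMeasure_apply_eq_zero_iff, Set.disjoint_left]
      intro ω hω hF
      rw [PMF.mem_support_iff, percolation_apply] at hω
      refine hω (if_neg fun h' => h (hF.trans h'))
    rw [this]
    exact zero_le

end Percolation

/-! ### Stationarity of the Potts measure -/

section Stationarity

variable {V : Type} [Fintype V] {q : ℕ} [NeZero q]

theorem mem_edgeSet_of_mem_monoEdges {G : SimpleGraph V} {σ : V → Fin q} {e : Sym2 V}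
    (he : e ∈ monoEdges G σ) : e ∈ G.edgeSet := by
  classical
  exact (Finset.mem_filter.1 he).2.1

/-- The closed edges contribute `exp (-β)` each and cancel their share of the Gibbs weight, so the
joint (Edwards-Sokal) weight depends on ω alone. -/
theorem potts_mul_percolation (G : SimpleGraph V) (β : ℝ≥0) (σ : V → Fin q)
    {ω : Finset (Sym2 V)} (h : ω ⊆ monoEdges G σ) :
    ENNReal.ofReal (Real.exp (β * (monoEdges G σ).card)) * percolation β (monoEdges G σ) ω
      = ENNReal.ofReal (edgeProb β ^ ω.card * Real.exp (β * ω.card)) := by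
  classical
  rw [percolation_apply, if_pos h, ← ENNReal.ofReal_mul (Real.exp_nonneg _), one_sub_edgeProb,
    ← Real.exp_nat_mul, Nat.cast_sub (Finset.card_le_card h)]
  congr 1
  rw [mul_left_comm, ← Real.exp_add]
  congr 2
  ring

theorem potts_detailed_balance (G : SimpleGraph V) (β : ℝ≥0) (σ τ : V → Fin q) :
    potts G β σ * step G β σ τ = potts G β τ * step G β τ σ := by
  classical
  -- Summed over the intermediate ω, the unnormalised flow from σ to τ is visibly symmetric in the
  -- two configurations.
  have key : ∀ σ τ : V → Fin q,
      ENNReal.ofReal (Real.exp (β * (monoEdges G σ).card)) * step G β σ τ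
        = ∑ ω : Finset (Sym2 V), if ω ⊆ monoEdges G σ ∧ ω ⊆ monoEdges G τ then
          ENNReal.ofReal (edgeProb β ^ ω.card * Real.exp (β * ω.card)) *
            (Fintype.card (Component ω → Fin q) : ℝ≥0∞)⁻¹ else 0 := by
    intro σ τ
    unfold step
    rw [PMF.bind_apply, tsum_fintype, Finset.mul_sum]
    refine Finset.sum_congr rfl fun ω _ => ?_
    by_cases h : ω ⊆ monoEdges G σ
    · rw [← mul_assoc, potts_mul_percolation G β σ h,
        recolour_apply (fun e he => mem_edgeSet_of_mem_monoEdges (h he))]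
      by_cases h' : ω ⊆ monoEdges G τ
      · rw [if_pos h', if_pos ⟨h, h'⟩]
      · rw [if_neg h', if_neg fun h'' => h' h''.2, mul_zero]
    · rw [percolation_apply, if_neg h, if_neg fun h'' => h h''.1, zero_mul, mul_zero]
  unfold potts
  rw [PMF.normalize_apply, PMF.normalize_apply, mul_right_comm, key σ τ, mul_right_comm, key τ σ]
  simp_rw [and_comm]

/-- The Potts measure is stationary for the Swendsen-Wang dynamics. -/
theorem potts_bind_step (G : SimpleGraph V) (β : ℝ≥0) :
    (potts (q := q) G β).bind (step G β) = potts G β := by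
  ext τ
  rw [PMF.bind_apply]
  simp_rw [potts_detailed_balance G β _ τ]
  rw [ENNReal.tsum_mul_left, PMF.tsum_coe, mul_one]

end Stationarity

/-! ### The backward history -/

section History

variable {V : Type} [Fintype V] {q : ℕ} [NeZero q]

open Classical in
/-- All edges of `G`. -/
def allEdges (G : SimpleGraph V) : Finset (Sym2 V) := Finset.univ.filter fun e => e ∈ G.edgeSet

theorem monoEdges_subset_allEdges (G : SimpleGraph V) (σ : V → Fin q) :
    monoEdges G σ ⊆ allEdges G := by
  classical
  intro e he
  exact Finset.mem_filter.2 ⟨Finset.mem_univ _, mem_edgeSet_of_mem_monoEdges he⟩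

open Classical in
/-- The recolouring of `σ` when the set of edges `ω` is open, if monochromatic. -/
def recolourStep (G : SimpleGraph V) (ω : Finset (Sym2 V)) (σ : V → Fin q) : PMF (V → Fin q) :=
  recolour q (ω ∩ monoEdges G σ)

/-- The Swendsen-Wang step with percolation on all the edges. -/
theorem step_eq_bind (G : SimpleGraph V) (β : ℝ≥0) (σ : V → Fin q) :
    step G β σ = (percolation β (allEdges G)).bind fun ω => recolourStep G ω σ := by
  classical
  unfold step
  rw [← percolation_map_inter β (monoEdges_subset_allEdges G σ), PMF.bind_map]
  rfl

open Classical in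
/-- The union of the non-trivial open clusters that meet `A`. -/
def hull (ω : Finset (Sym2 V)) (A : Finset V) : Finset V :=
  Finset.univ.filter fun w => ∃ v ∈ A, (openGraph ω).Reachable v w ∧ ∃ x, (openGraph ω).Adj v x

theorem mem_hull {ω : Finset (Sym2 V)} {A : Finset V} {w : V} : w ∈ hull ω A ↔
    ∃ v ∈ A, (openGraph ω).Reachable v w ∧ ∃ x, (openGraph ω).Adj v x := by
  simp [hull]

theorem exists_adj_of_reachable {G : SimpleGraph V} {v x y : V} (h : G.Reachable v x)
    (hxy : G.Adj x y) : ∃ z, G.Adj v z := by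
  obtain ⟨p⟩ := h
  cases p with
  | nil => exact ⟨_, hxy⟩
  | cons h _ => exact ⟨_, h⟩

open Classical in
-- A path explored from a vertex of `A` along open edges never leaves the hull, where σ and σ'
-- agree, so each of its edges stays monochromatic.
theorem reachable_inter_monoEdges {G : SimpleGraph V} {ω : Finset (Sym2 V)} {A : Finset V}
    {σ σ' : V → Fin q} (hσ : ∀ v ∈ hull ω A, σ v = σ' v) {v w : V} (hv : v ∈ A)
    (h : (openGraph (ω ∩ monoEdges G σ)).Reachable v w) :
    (openGraph (ω ∩ monoEdges G σ')).Reachable v w := by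
  rw [SimpleGraph.reachable_iff_reflTransGen] at h
  have hle : openGraph (ω ∩ monoEdges G σ') ≤ openGraph ω :=
    SimpleGraph.fromEdgeSet_mono (by simp)
  induction h with
  | refl => exact SimpleGraph.Reachable.refl v
  | @tail x y _ hxy ih =>
    refine ih.trans (SimpleGraph.Adj.reachable ?_)
    rw [SimpleGraph.fromEdgeSet_adj, Finset.mem_coe, Finset.mem_inter, mk_mem_monoEdges] at hxy ⊢
    have hω : (openGraph ω).Adj x y :=
      (SimpleGraph.fromEdgeSet_adj _).2 ⟨Finset.mem_coe.2 hxy.1.1, hxy.2⟩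
    have hx := ih.mono hle
    have hz := exists_adj_of_reachable hx hω
    refine ⟨⟨hxy.1.1, hxy.1.2.1, ?_⟩, hxy.2⟩
    rw [← hσ x (mem_hull.2 ⟨v, hv, hx, hz⟩),
      ← hσ y (mem_hull.2 ⟨v, hv, hx.trans hω.reachable, hz⟩)]
    exact hxy.1.2.2

/-- The hull may omit the isolated vertices of `A`: such a vertex is its own cluster for every σ.
This omission is why histories die out. -/
theorem proj_recolourStep_congr (G : SimpleGraph V) (ω : Finset (Sym2 V)) (A : Finset V)
    (σ σ' : V → Fin q) (hσ : ∀ v ∈ hull ω A, σ v = σ' v) :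
    proj A (recolourStep G ω σ) = proj A (recolourStep G ω σ') :=
  proj_recolour_congr A _ _ fun _ hv => Set.ext fun _ =>
    ⟨reachable_inter_monoEdges hσ hv, reachable_inter_monoEdges (fun v hv => (hσ v hv).symm) hv⟩

/-- The law of `s` independent percolations, at the levels `0, …, s - 1`. -/
def percolations (G : SimpleGraph V) (β : ℝ≥0) : ℕ → PMF (ℕ → Finset (Sym2 V))
  -- Levels from `s` on carry no open edge, so edge sets that reach such levels are never open.
  | 0 => PMF.pure fun _ => ∅
  | s + 1 => (percolation β (allEdges G)).bind fun ω =>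
      (percolations G β s).map fun η => Function.update η s ω

/-- The history of `A` after going down through the levels `s - 1, …, 0`. -/
def history (η : ℕ → Finset (Sym2 V)) : ℕ → Finset V → Finset V
  | 0, A => A
  | s + 1, A => history η s (hull (η s) A)

theorem history_congr {η η' : ℕ → Finset (Sym2 V)} {s : ℕ} (h : ∀ u < s, η u = η' u)
    (A : Finset V) : history η s A = history η' s A := by
  induction s generalizing A with
  | zero => rfl
  | succ s ih =>
    simp only [history]
    rw [h s (Nat.lt_succ_self s), ih fun u hu => h u (hu.trans (Nat.lt_succ_self s))]

/-- The law of the history of `A` after `s` steps. -/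
def historyLaw (G : SimpleGraph V) (β : ℝ≥0) (s : ℕ) (A : Finset V) : PMF (Finset V) :=
  (percolations G β s).map fun η => history η s A

theorem historyLaw_zero (G : SimpleGraph V) (β : ℝ≥0) (A : Finset V) :
    historyLaw G β 0 A = PMF.pure A := by
  unfold historyLaw percolations
  rw [PMF.pure_map]
  rfl

theorem historyLaw_succ (G : SimpleGraph V) (β : ℝ≥0) (s : ℕ) (A : Finset V) :
    historyLaw G β (s + 1) A =
      (percolation β (allEdges G)).bind fun ω => historyLaw G β s (hull ω A) := by
  unfold historyLaw
  rw [percolations, PMF.map_bind]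
  congr 1
  funext ω
  rw [PMF.map_comp]
  congr 1
  funext η
  simp only [Function.comp, history, Function.update_self]
  exact history_congr (fun u hu => Function.update_of_ne hu.ne _ _) _

theorem law_add (G : SimpleGraph V) (β : ℝ≥0) (x₀ : V → Fin q) (t s : ℕ) :
    law G β x₀ (t + s) = (fun μ : PMF (V → Fin q) => μ.bind (step G β))^[s] (law G β x₀ t) := by
  induction s with
  | zero => rfl
  | succ s ih => rw [Function.iterate_succ_apply', ← ih]; rfl

theorem potts_iterate (G : SimpleGraph V) (β : ℝ≥0) (s : ℕ) :
    (fun μ : PMF (V → Fin q) => μ.bind (step G β))^[s] (potts G β) = potts G β :=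
  Function.iterate_fixed (potts_bind_step G β) s

/-- The distance after `s` steps on `A` is bounded by the mean distance on the history of `A`. -/
theorem tv_proj_iterate_le [DecidableEq V] (G : SimpleGraph V) (β : ℝ≥0) (s : ℕ) (A : Finset V)
    (μ ν : PMF (V → Fin q)) :
    tv (proj A ((fun μ : PMF (V → Fin q) => μ.bind (step G β))^[s] μ))
        (proj A ((fun μ : PMF (V → Fin q) => μ.bind (step G β))^[s] ν))
      ≤ ∑ Δ, (historyLaw G β s A Δ).toReal * tv (proj Δ μ) (proj Δ ν) := by
  induction s generalizing A with
  | zero =>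
    rw [historyLaw_zero, Finset.sum_eq_single A]
    · simp
    · intro B _ hB
      rw [PMF.pure_apply_of_ne _ _ hB]; simp
    · simp
  | succ s ih =>
    rw [Function.iterate_succ_apply', Function.iterate_succ_apply']
    set μ' := (fun μ : PMF (V → Fin q) => μ.bind (step G β))^[s] μ
    set ν' := (fun μ : PMF (V → Fin q) => μ.bind (step G β))^[s] ν
    have hstep : ∀ κ : PMF (V → Fin q), proj A (κ.bind (step G β))
        = (percolation β (allEdges G)).bind fun ω =>
          proj A (κ.bind fun σ => recolourStep G ω σ) := by
      intro κ
      have : κ.bind (step G β) = (percolation β (allEdges G)).bind fun ω =>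
          κ.bind fun σ => recolourStep G ω σ := by
        -- The percolation on all edges is independent of the configuration, hence may be drawn
        -- before it.
        rw [PMF.bind_comm]
        congr 1
        funext σ
        exact step_eq_bind G β σ
      rw [this]
      unfold proj
      rw [PMF.map_bind]
    rw [hstep, hstep]
    refine (tv_mixture_le _ _ _).trans ?_
    calc _ ≤ ∑ ω, (percolation β (allEdges G) ω).toReal *
          ∑ Δ, (historyLaw G β s (hull ω A) Δ).toReal * tv (proj Δ μ) (proj Δ ν) := by
          refine Finset.sum_le_sum fun ω _ => mul_le_mul_of_nonneg_left ?_ ENNReal.toReal_nonneg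
          exact (tv_proj_bind_le A (hull ω A) _
            (proj_recolourStep_congr G ω A) μ' ν').trans (ih _)
      _ = _ := by
          simp_rw [Finset.mul_sum]
          rw [Finset.sum_comm]
          refine Finset.sum_congr rfl fun Δ _ => ?_
          rw [historyLaw_succ, toReal_bind_apply, Finset.sum_mul]
          refine Finset.sum_congr rfl fun ω _ => ?_
          ring

end History

/-! ### Space-time paths -/

section SpaceTime

variable {V : Type} [Fintype V]

/-- All the space-time edges in `F` are open. -/
def AllOpen (F : Finset (ℕ × Sym2 V)) (η : ℕ → Finset (Sym2 V)) : Prop := ∀ x ∈ F, x.2 ∈ η x.1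

theorem subset_allEdges_of_mem_support {G : SimpleGraph V} {β : ℝ≥0} {s : ℕ}
    {η : ℕ → Finset (Sym2 V)} (hη : η ∈ (percolations G β s).support) (u : ℕ) :
    η u ⊆ allEdges G := by
  classical
  induction s generalizing η with
  | zero =>
    rw [percolations, PMF.support_pure, Set.mem_singleton_iff] at hη
    subst hη
    exact Finset.empty_subset _
  | succ s ih =>
    rw [percolations, PMF.mem_support_bind_iff] at hη
    obtain ⟨ω, hω, hη⟩ := hη
    rw [PMF.mem_support_map_iff] at hη
    obtain ⟨η', hη', rfl⟩ := hη
    by_cases hu : u = s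
    · subst hu
      rw [Function.update_self]
      by_contra hne
      rw [PMF.mem_support_iff, percolation_apply, if_neg hne] at hω
      exact hω rfl
    · rw [Function.update_of_ne hu]
      exact ih hη'

/-- Levels are independent: the edges of the top level are split off and charged to its percolation,
the others to the lower levels. -/
theorem percolations_allOpen_le (G : SimpleGraph V) (β : ℝ≥0) (s : ℕ)
    (F : Finset (ℕ × Sym2 V)) :
    (percolations G β s).toOuterMeasure {η | AllOpen F η}
      ≤ ENNReal.ofReal (edgeProb β) ^ F.card := by
  classical
  induction s generalizing F with
  | zero =>
    rw [percolations, PMF.toOuterMeasure_pure_apply]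
    split_ifs with h
    · rcases F.eq_empty_or_nonempty with rfl | ⟨x, hx⟩
      · simp
      · exact absurd (h x hx) (by simp)
    · exact zero_le
  | succ s ih =>
    set F₁ := (F.filter fun x => x.1 = s).image Prod.snd with hF₁
    set F₂ := F.filter fun x => ¬ x.1 = s with hF₂
    have hcard : F.card = F₁.card + F₂.card := by
      rw [hF₁, Finset.card_image_of_injOn, Finset.card_filter_add_card_filter_not]
      rintro ⟨a, b⟩ ha ⟨a', b'⟩ ha' h
      simp only [Finset.coe_filter, Set.mem_ofPred_eq] at ha ha'
      exact Prod.ext (ha.2.trans ha'.2.symm) h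
    rw [percolations, PMF.toOuterMeasure_bind_apply]
    have hω : ∀ ω, ((percolations G β s).map fun η => Function.update η s ω).toOuterMeasure
        {η | AllOpen F η} ≤ Set.indicator {ω | F₁ ⊆ ω}
          (fun _ => ENNReal.ofReal (edgeProb β) ^ F₂.card) ω := by
      intro ω
      rw [PMF.toOuterMeasure_map_apply]
      by_cases h : F₁ ⊆ ω
      · rw [Set.indicator_of_mem (by simpa using h)]
        refine le_trans (MeasureTheory.OuterMeasure.mono _ ?_) (ih F₂)
        intro η hη x hx
        have hx' := Finset.mem_filter.1 hx
        have : x.2 ∈ Function.update η s ω x.1 := hη x hx'.1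
        rwa [Function.update_of_ne hx'.2] at this
      · have : (fun η => Function.update η s ω) ⁻¹' {η | AllOpen F η} = ∅ := by
          rw [Set.eq_empty_iff_forall_notMem]
          intro η hη
          refine h fun e he => ?_
          obtain ⟨x, hx, rfl⟩ := Finset.mem_image.1 he
          have hx' := Finset.mem_filter.1 hx
          have : x.2 ∈ Function.update η s ω x.1 := hη x hx'.1
          rwa [hx'.2, Function.update_self] at this
        rw [this]
        simp
    calc _ ≤ ∑' ω, percolation β (allEdges G) ω * Set.indicator {ω | F₁ ⊆ ω}
          (fun _ => ENNReal.ofReal (edgeProb β) ^ F₂.card) ω :=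
          ENNReal.tsum_le_tsum fun ω => mul_le_mul_right (hω ω) _
      _ = (percolation β (allEdges G)).toOuterMeasure {ω | F₁ ⊆ ω} *
          ENNReal.ofReal (edgeProb β) ^ F₂.card := by
          rw [PMF.toOuterMeasure_apply, ← ENNReal.tsum_mul_right]
          refine tsum_congr fun ω => ?_
          by_cases h : F₁ ⊆ ω
          · rw [Set.indicator_of_mem (by simpa using h), Set.indicator_of_mem (by simpa using h)]
          · rw [Set.indicator_of_notMem (by simpa using h),
              Set.indicator_of_notMem (by simpa using h), mul_zero, zero_mul]
      _ ≤ _ := by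
          rw [hcard, pow_add]
          exact mul_le_mul_left (percolation_subset_le β _ _) _

theorem percolations_exists_allOpen_le (G : SimpleGraph V) (β : ℝ≥0) (s k : ℕ)
    (𝓕 : Finset (Finset (ℕ × Sym2 V))) (h𝓕 : ∀ F ∈ 𝓕, F.card = k) :
    (percolations G β s).toOuterMeasure {η | ∃ F ∈ 𝓕, AllOpen F η}
      ≤ 𝓕.card * ENNReal.ofReal (edgeProb β) ^ k := by
  have : {η : ℕ → Finset (Sym2 V) | ∃ F ∈ 𝓕, AllOpen F η} = ⋃ F ∈ 𝓕, {η | AllOpen F η} := by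
    ext; simp
  rw [this]
  refine (MeasureTheory.measure_biUnion_finset_le 𝓕 _).trans ?_
  rw [← nsmul_eq_mul]
  refine Finset.sum_le_card_nsmul _ _ _ fun F hF => ?_
  rw [← h𝓕 F hF]
  exact percolations_allOpen_le G β s F

open Classical in
/-- The neighbours of a vertex. -/
def neighbours (G : SimpleGraph V) (v : V) : Finset V := Finset.univ.filter (G.Adj v)

open Classical in
/-- The edge sets of space-time paths with `M` edges that start at the vertex `w` of level `s - 1`;
after each edge the path goes on in the same level, or moves one level down from one of the two
end points of the edge. -/
def pathSets (G : SimpleGraph V) : ℕ → ℕ → V → Finset (Finset (ℕ × Sym2 V))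
  | 0, _, _ => {∅}
  | _ + 1, 0, _ => ∅
  | M + 1, u + 1, w => (neighbours G w).biUnion fun x =>
      -- The continuation `(u, w)` serves a vertex kept in its own history: it needs an open edge at
      -- this level, but the history goes on from the vertex itself.
      ({(u + 1, x), (u, x), (u, w)} : Finset (ℕ × V)).biUnion fun y =>
        (pathSets G M y.1 y.2).image (insert (u, s(w, x)))

theorem card_pathSets_le {G : SimpleGraph V} {D : ℕ} (hD : ∀ v, (neighbours G v).card ≤ D)
    (M s : ℕ) (w : V) : (pathSets G M s w).card ≤ (3 * D) ^ M := by
  classical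
  induction M generalizing s w with
  | zero => simp [pathSets]
  | succ M ih =>
    cases s with
    | zero => simp [pathSets]
    | succ u =>
      rw [pathSets]
      have h1 : ∀ x, (({(u + 1, x), (u, x), (u, w)} : Finset (ℕ × V)).biUnion fun y =>
          (pathSets G M y.1 y.2).image (insert (u, s(w, x)))).card ≤ 3 * (3 * D) ^ M := by
        intro x
        refine (Finset.card_biUnion_le_card_mul _ _ _ fun y _ =>
          Finset.card_image_le.trans (ih y.1 y.2)).trans ?_
        exact Nat.mul_le_mul_right _ Finset.card_le_three
      refine (Finset.card_biUnion_le_card_mul _ _ _ fun x _ => h1 x).trans ?_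
      calc _ ≤ D * (3 * (3 * D) ^ M) := Nat.mul_le_mul_right _ (hD w)
        _ = _ := by ring

open Classical in
theorem insert_mem_pathSets {G : SimpleGraph V} {M u : ℕ} {w x : V}
    {y : ℕ × V} {F : Finset (ℕ × Sym2 V)} (hx : G.Adj w x)
    (hy : y = (u + 1, x) ∨ y = (u, x) ∨ y = (u, w)) (hF : F ∈ pathSets G M y.1 y.2) :
    insert (u, s(w, x)) F ∈ pathSets G (M + 1) (u + 1) w := by
  rw [pathSets, Finset.mem_biUnion]
  refine ⟨x, by simpa [neighbours] using hx, ?_⟩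
  rw [Finset.mem_biUnion]
  refine ⟨y, by simpa using hy, ?_⟩
  rw [Finset.mem_image]
  exact ⟨F, hF, rfl⟩

/-- A natural-number valued distance for which adjacent vertices are at distance at most one. -/
structure IsGraphDist (G : SimpleGraph V) (dist : V → V → ℕ) : Prop where
  self : ∀ v, dist v v = 0
  symm : ∀ v w, dist v w = dist w v
  triangle : ∀ u v w, dist u w ≤ dist u v + dist v w
  adj : ∀ v w, G.Adj v w → dist v w ≤ 1

variable {G : SimpleGraph V} {dist : V → V → ℕ}

/-- Each edge moves the path by at most one step, and changing level does not move it. This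
confinement makes paths from distant starting points edge-disjoint. -/
theorem dist_le_of_mem_pathSets (hd : IsGraphDist G dist) {M s : ℕ} {w : V}
    {F : Finset (ℕ × Sym2 V)} (hF : F ∈ pathSets G M s w) {x : ℕ × Sym2 V} (hx : x ∈ F) {y : V}
    (hy : y ∈ x.2) : dist w y ≤ M := by
  classical
  induction M generalizing s w F with
  | zero =>
    rw [pathSets, Finset.mem_singleton] at hF
    subst hF
    simp at hx
  | succ M ih =>
    cases s with
    | zero => simp [pathSets] at hF
    | succ u =>
      simp only [pathSets, Finset.mem_biUnion, Finset.mem_image] at hF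
      obtain ⟨z, hz, a, ha, F', hF', rfl⟩ := hF
      have hz : G.Adj w z := by simpa [neighbours] using hz
      have hwz := hd.adj w z hz
      rcases Finset.mem_insert.1 hx with rfl | hx
      · rcases Sym2.mem_iff.1 hy with rfl | rfl
        · rw [hd.self]; omega
        · omega
      · have h1 := ih hF' hx
        have h2 : dist w a.2 ≤ 1 := by
          simp only [Finset.mem_insert, Finset.mem_singleton] at ha
          rcases ha with rfl | rfl | rfl
          · exact hwz
          · exact hwz
          · simp [hd.self]
        have := hd.triangle w a.2 y
        omega

/-- An open path with `M` distinct space-time edges starts at `v` in level `s - 1`. -/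
def HasOpenPath (G : SimpleGraph V) (M s : ℕ) (v : V) (η : ℕ → Finset (Sym2 V)) : Prop :=
  ∃ F ∈ pathSets G M s v, F.card = M ∧ AllOpen F η

/-- Prepends a trail of level `s` to a path through lower levels. A trail does not repeat edges and
the level index separates it from the rest, so lengths add; truncation gives every smaller `M`. -/
theorem exists_pathSets_of_walk (η : ℕ → Finset (Sym2 V)) (hη : ∀ u, η u ⊆ allEdges G)
    {s N : ℕ} {v w : V} (p : (openGraph (η s)).Walk v w) (hp : p.IsTrail) (hl : 1 ≤ p.length)
    (hw : ∀ M ≤ N, ∃ F ∈ pathSets G M s w, F.card = M ∧ AllOpen F η ∧ ∀ x ∈ F, x.1 < s) :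
    ∀ M ≤ p.length + N, ∃ F ∈ pathSets G M (s + 1) v, F.card = M ∧ AllOpen F η ∧
      ∀ x ∈ F, x.1 < s ∨ x.1 = s ∧ x.2 ∈ p.edges := by
  classical
  induction p with
  | nil => simp at hl
  | @cons v x w h p ih =>
    rintro (_ | M) hM
    · exact ⟨∅, by simp [pathSets], by simp, by simp [AllOpen], by simp⟩
    rw [SimpleGraph.Walk.isTrail_cons] at hp
    have hopen : s(v, x) ∈ η s := ((SimpleGraph.fromEdgeSet_adj _).1 h).1
    have hadj : G.Adj v x := by simpa [allEdges] using hη s hopen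
    have hM' : M ≤ p.length + N := by
      rw [SimpleGraph.Walk.length_cons] at hM
      omega
    obtain ⟨y, hy, F, hF, hc, ho, hl⟩ : ∃ y : ℕ × V,
        (y = (s + 1, x) ∨ y = (s, x) ∨ y = (s, v)) ∧ ∃ F ∈ pathSets G M y.1 y.2, F.card = M ∧
        AllOpen F η ∧ ∀ x ∈ F, x.1 < s ∨ x.1 = s ∧ x.2 ∈ p.edges := by
      -- After its last edge the trail drops one level from its end point; before that it stays in
      -- the level.
      rcases Nat.eq_zero_or_pos p.length with h0 | h0
      · have hxw := SimpleGraph.Walk.eq_of_length_eq_zero h0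
        subst hxw
        obtain ⟨F, hF, hc, ho, hl⟩ := hw M (by omega)
        exact ⟨(s, x), by simp, F, hF, hc, ho, fun z hz => Or.inl (hl z hz)⟩
      · obtain ⟨F, hF, hc, ho, hl⟩ := ih hp.1 h0 hw M hM'
        exact ⟨(s + 1, x), by simp, F, hF, hc, ho, hl⟩
    refine ⟨insert (s, s(v, x)) F, insert_mem_pathSets hadj hy hF, ?_, ?_, ?_⟩
    · rw [Finset.card_insert_of_notMem, hc]
      intro hmem
      rcases hl _ hmem with h1 | h1
      · exact lt_irrefl _ h1
      · exact hp.2 h1.2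
    · intro z hz
      rcases Finset.mem_insert.1 hz with rfl | hz
      · exact hopen
      · exact ho z hz
    · intro z hz
      rcases Finset.mem_insert.1 hz with rfl | hz
      · exact Or.inr ⟨rfl, by simp⟩
      · exact (hl z hz).imp_right fun h => ⟨h.1, by simp [h.2]⟩

/-- `N` counts the edges of an ancestral path. Every level contributes at least one edge, because
the hull ignores isolated vertices, and at least the distance moved in it. -/
theorem exists_pathSets_of_mem_history (hd : IsGraphDist G dist) (η : ℕ → Finset (Sym2 V))
    (hη : ∀ u, η u ⊆ allEdges G) {s : ℕ} {A : Finset V} {h : V} (hh : h ∈ history η s A) :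
    ∃ v ∈ A, ∃ N, s ≤ N ∧ dist v h ≤ N ∧ ∀ M ≤ N, ∃ F ∈ pathSets G M s v,
      F.card = M ∧ AllOpen F η ∧ ∀ x ∈ F, x.1 < s := by
  classical
  induction s generalizing A with
  | zero =>
    refine ⟨h, hh, 0, le_rfl, (hd.self h).le, fun M hM => ?_⟩
    obtain rfl : M = 0 := by omega
    exact ⟨∅, by simp [pathSets], by simp, by simp [AllOpen], by simp⟩
  | succ s ih =>
    obtain ⟨w, hw, N, hsN, hdN, hN⟩ := ih hh
    obtain ⟨v, hv, hreach, x, hx⟩ := mem_hull.1 hw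
    have hadjG : ∀ a b, (openGraph (η s)).Adj a b → G.Adj a b := by
      intro a b hab
      simpa [allEdges] using hη s ((SimpleGraph.fromEdgeSet_adj _).1 hab).1
    refine ⟨v, hv, ?_⟩
    -- If the ancestor does not move, the connecting path is empty; the open edge at `v` granted by
    -- the hull supplies the edge of this level.
    by_cases hvw : v = w
    · subst hvw
      refine ⟨N + 1, by omega, by omega, ?_⟩
      rintro (_ | M) hM
      · exact ⟨∅, by simp [pathSets], by simp, by simp [AllOpen], by simp⟩
      obtain ⟨F, hF, hc, ho, hl⟩ := hN M (by omega)
      refine ⟨insert (s, s(v, x)) F, insert_mem_pathSets (y := (s, v)) (hadjG _ _ hx) (by simp) hF,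
        ?_, ?_, ?_⟩
      · rw [Finset.card_insert_of_notMem, hc]
        exact fun hmem => lt_irrefl _ (hl _ hmem)
      · intro z hz
        rcases Finset.mem_insert.1 hz with rfl | hz
        · exact ((SimpleGraph.fromEdgeSet_adj _).1 hx).1
        · exact ho z hz
      · intro z hz
        rcases Finset.mem_insert.1 hz with rfl | hz
        · exact Nat.lt_succ_self s
        · exact (hl z hz).trans (Nat.lt_succ_self s)
    · obtain ⟨p, hp⟩ := hreach.exists_isPath
      have hlen : 1 ≤ p.length := by
        by_contra h0
        exact hvw (SimpleGraph.Walk.eq_of_length_eq_zero (by omega : p.length = 0))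
      have hdist : dist v w ≤ p.length := by
        clear hlen hp hN hdN hw hreach hx hvw hv
        induction p with
        | nil => simp [hd.self]
        | @cons a b c hab p ih' =>
          have h1 := hd.adj _ _ (hadjG _ _ hab)
          have h2 := hd.triangle a b c
          rw [SimpleGraph.Walk.length_cons]
          omega
      have htri := hd.triangle v w h
      refine ⟨p.length + N, by omega, by omega, fun M hM => ?_⟩
      obtain ⟨F, hF, hc, ho, hl⟩ := exists_pathSets_of_walk η hη p hp.isTrail hlen hN M hM
      refine ⟨F, hF, hc, ho, fun z hz => ?_⟩
      rcases hl z hz with h1 | h1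
      · omega
      · omega

/-- Every vertex of the history descends from a vertex with long open paths. -/
theorem exists_hasOpenPath_of_mem_history (hd : IsGraphDist G dist) (η : ℕ → Finset (Sym2 V))
    (hη : ∀ u, η u ⊆ allEdges G) {s : ℕ} {A : Finset V} {h : V} (hh : h ∈ history η s A) :
    ∃ v ∈ A, HasOpenPath G s s v η ∧ ∀ R ≤ dist v h, HasOpenPath G R s v η := by
  obtain ⟨v, hv, N, hsN, hdN, hN⟩ := exists_pathSets_of_mem_history hd η hη hh
  have key : ∀ M ≤ N, HasOpenPath G M s v η := fun M hM => by
    obtain ⟨F, hF, hc, ho, -⟩ := hN M hM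
    exact ⟨F, hF, hc, ho⟩
  exact ⟨v, hv, key s hsN, fun R hR => key R (hR.trans hdN)⟩

/-- The vertices of `T` are at distance more than `r` from each other. -/
def Separated (dist : V → V → ℕ) (r : ℕ) (T : Finset V) : Prop :=
  ∀ v ∈ T, ∀ w ∈ T, v ≠ w → r < dist v w

/-- Paths with `M` edges stay within distance `M` of their starts, so those from points more than `2
* M` apart share no edge and their union has full cardinality. The distance clause is there to carry
the induction. -/
theorem exists_family_of_separated (hd : IsGraphDist G dist) {D : ℕ}
    (hD : ∀ v, (neighbours G v).card ≤ D) (M s : ℕ) (T : Finset V)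
    (hT : Separated dist (2 * M) T) :
    ∃ 𝓕 : Finset (Finset (ℕ × Sym2 V)), 𝓕.card ≤ ((3 * D) ^ M) ^ T.card ∧
      (∀ F ∈ 𝓕, F.card = M * T.card ∧ ∀ x ∈ F, ∃ v ∈ T, ∀ y ∈ x.2, dist v y ≤ M) ∧
      ∀ η, (∀ v ∈ T, HasOpenPath G M s v η) → ∃ F ∈ 𝓕, AllOpen F η := by
  classical
  induction T using Finset.induction_on with
  | empty => exact ⟨{∅}, by simp, by simp, fun η _ => ⟨∅, by simp, by simp [AllOpen]⟩⟩
  | insert v T hv ih =>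
    obtain ⟨𝓕, h1, h2, h3⟩ := ih fun a ha b hb =>
      hT a (Finset.mem_insert_of_mem ha) b (Finset.mem_insert_of_mem hb)
    refine ⟨Finset.image₂ (· ∪ ·) ((pathSets G M s v).filter fun F => F.card = M) 𝓕, ?_, ?_, ?_⟩
    · refine Finset.card_image₂_le _ _ _ |>.trans ?_
      rw [Finset.card_insert_of_notMem hv, pow_succ']
      exact Nat.mul_le_mul ((Finset.card_filter_le _ _).trans (card_pathSets_le hD M s v)) h1
    · intro F hF
      obtain ⟨F₁, hF₁, F₂, hF₂, rfl⟩ := Finset.mem_image₂.1 hF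
      rw [Finset.mem_filter] at hF₁
      obtain ⟨hc, hl⟩ := h2 F₂ hF₂
      constructor
      · rw [Finset.card_union_of_disjoint, hF₁.2, hc, Finset.card_insert_of_notMem hv]
        · ring
        · rw [Finset.disjoint_left]
          intro x hx1 hx2
          obtain ⟨w, hw, hwx⟩ := hl x hx2
          obtain ⟨y, hy⟩ : ∃ y, y ∈ x.2 := by
            obtain ⟨a, b⟩ := x
            induction b with
            | _ y z => exact ⟨y, Sym2.mem_mk_left y z⟩
          have e1 := hwx y hy
          have e2 := dist_le_of_mem_pathSets hd hF₁.1 hx1 hy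
          have e3 := hd.triangle v y w
          have e4 := hd.symm w y
          have hvw : v ≠ w := fun h => hv (h ▸ hw)
          have := hT v (Finset.mem_insert_self _ _) w (Finset.mem_insert_of_mem hw) hvw
          omega
      · intro x hx
        rcases Finset.mem_union.1 hx with hx | hx
        · exact ⟨v, Finset.mem_insert_self _ _, fun y hy =>
            dist_le_of_mem_pathSets hd hF₁.1 hx hy⟩
        · obtain ⟨w, hw, h⟩ := hl x hx
          exact ⟨w, Finset.mem_insert_of_mem hw, h⟩
    · intro η hη
      obtain ⟨F₁, hF₁, hc₁, ho₁⟩ := hη v (Finset.mem_insert_self _ _)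
      obtain ⟨F₂, hF₂, ho₂⟩ := h3 η fun w hw => hη w (Finset.mem_insert_of_mem hw)
      refine ⟨F₁ ∪ F₂, Finset.mem_image₂_of_mem (Finset.mem_filter.2 ⟨hF₁, hc₁⟩) hF₂, ?_⟩
      intro x hx
      rcases Finset.mem_union.1 hx with hx | hx
      · exact ho₁ x hx
      · exact ho₂ x hx

/-- The probability that long open paths start at all vertices of a separated set is at most the
product of the individual bounds. -/
theorem percolations_hasOpenPath_le (hd : IsGraphDist G dist) {D : ℕ}
    (hD : ∀ v, (neighbours G v).card ≤ D) (β : ℝ≥0) (M s s' : ℕ) (T : Finset V)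
    (hT : Separated dist (2 * M) T) :
    (percolations G β s').toOuterMeasure {η | ∀ v ∈ T, HasOpenPath G M s v η}
      ≤ ((3 * D * ENNReal.ofReal (edgeProb β)) ^ M) ^ T.card := by
  obtain ⟨𝓕, h1, h2, h3⟩ := exists_family_of_separated hd hD M s T hT
  refine (MeasureTheory.OuterMeasure.mono _ (fun η hη => h3 η hη)).trans ?_
  refine (percolations_exists_allOpen_le G β s' _ 𝓕 fun F hF => (h2 F hF).1).trans ?_
  rw [mul_pow, mul_pow, pow_mul]
  gcongr
  exact_mod_cast h1

/-- A union bound over a family of sets. -/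
theorem percolations_exists_hasOpenPath_le (hd : IsGraphDist G dist) {D : ℕ}
    (hD : ∀ v, (neighbours G v).card ≤ D) (β : ℝ≥0) (M s s' L : ℕ) (𝓣 : Finset (Finset V)) :
    (percolations G β s').toOuterMeasure
        {η | ∃ T ∈ 𝓣, T.card = L ∧ Separated dist (2 * M) T ∧ ∀ v ∈ T, HasOpenPath G M s v η}
      ≤ 𝓣.card * ((3 * D * ENNReal.ofReal (edgeProb β)) ^ M) ^ L := by
  classical
  set 𝓣' := 𝓣.filter fun T => T.card = L ∧ Separated dist (2 * M) T
  have : {η : ℕ → Finset (Sym2 V) | ∃ T ∈ 𝓣, T.card = L ∧ Separated dist (2 * M) T ∧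
        ∀ v ∈ T, HasOpenPath G M s v η}
      = ⋃ T ∈ 𝓣', {η | ∀ v ∈ T, HasOpenPath G M s v η} := by
    ext
    simp [𝓣', and_assoc]
  rw [this]
  refine (MeasureTheory.measure_biUnion_finset_le 𝓣' _).trans ?_
  refine (Finset.sum_le_card_nsmul _ _ _ fun T hT => ?_).trans (b := 𝓣'.card •
    ((3 * D * ENNReal.ofReal (edgeProb β)) ^ M) ^ L) ?_
  · obtain ⟨-, h1, h2⟩ := Finset.mem_filter.1 hT
    rw [← h1]
    exact percolations_hasOpenPath_le hd hD β M s s' T h2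
  · rw [nsmul_eq_mul]
    gcongr
    exact Finset.filter_subset _ _

end SpaceTime

/-! ### Chains of separated vertices -/

section Chains

variable {V : Type} [Fintype V] {G : SimpleGraph V} {dist : V → V → ℕ}

open Classical in
/-- The vertex sets of the sequences of `N + 1` vertices that start at `v` and have steps of
length at most `B`. -/
def chainSets (dist : V → V → ℕ) (B : ℕ) : ℕ → V → Finset (Finset V)
  | 0, v => {{v}}
  | N + 1, v => (Finset.univ.filter fun w => dist v w ≤ B).biUnion fun w =>
      (chainSets dist B N w).image (insert v)

open Classical in
theorem card_chainSets_le {B C : ℕ}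
    (hC : ∀ v, (Finset.univ.filter fun w => dist v w ≤ B).card ≤ C) (N : ℕ) (v : V) :
    (chainSets dist B N v).card ≤ C ^ N := by
  induction N generalizing v with
  | zero => simp [chainSets]
  | succ N ih =>
    rw [chainSets, pow_succ']
    exact (Finset.card_biUnion_le_card_mul _ _ _ fun w _ =>
      Finset.card_image_le.trans (ih w)).trans (Nat.mul_le_mul_right _ (hC v))

/-- The last exit of a path from a set `P`. -/
theorem exists_last_exit {α : Type} {r : α → α → Prop} (P : α → Prop) {a b : α}
    (h : Relation.ReflTransGen r a b) (ha : P a) (hb : ¬ P b) :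
    ∃ x y, P x ∧ r x y ∧ ¬ P y ∧ Relation.ReflTransGen (fun x y => r x y ∧ ¬ P y) y b := by
  have key : (¬ P a ∧ Relation.ReflTransGen (fun x y => r x y ∧ ¬ P y) a b) ∨
      ∃ x y, P x ∧ r x y ∧ ¬ P y ∧ Relation.ReflTransGen (fun x y => r x y ∧ ¬ P y) y b := by
    clear ha
    induction h using Relation.ReflTransGen.head_induction_on with
    | refl => exact Or.inl ⟨hb, Relation.ReflTransGen.refl⟩
    | @head a c hac _ ih =>
      rcases ih with ⟨hc, ih⟩ | ih
      · by_cases ha : P a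
        · exact Or.inr ⟨a, c, ha, hac, hc, ih⟩
        · exact Or.inl ⟨ha, ih.head ⟨hac, hc⟩⟩
      · exact Or.inr ih
  exact key.resolve_left fun h => h.1 ha

/-- A path with short steps between distant points contains a separated chain; the points of the
chain may moreover be moved by a small distance. -/
theorem exists_chain (hd : IsGraphDist G dist) (g : V → V) (r ℓ ρ σ N : ℕ) (hρ : σ + 2 * r ≤ ρ)
    (H : V → Prop) (hg : ∀ h, H h → dist (g h) h ≤ r) {u v : V} (hu : H u)
    (huv : Relation.ReflTransGen (fun x y => dist x y ≤ ℓ ∧ H y) u v)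
    (hfar : N * (ρ + ℓ) < dist u v) :
    ∃ T ∈ chainSets dist (ρ + ℓ + 2 * r) N (g u), T.card = N + 1 ∧ Separated dist σ T ∧
      ∀ t ∈ T, ∃ h, H h ∧ g h = t := by
  classical
  induction N generalizing H u with
  | zero =>
    refine ⟨{g u}, by simp [chainSets], by simp, ?_, ?_⟩
    · intro a ha b hb hab
      rw [Finset.mem_singleton] at ha hb
      exact absurd (ha.trans hb.symm) hab
    · intro t ht
      exact ⟨u, hu, (Finset.mem_singleton.1 ht).symm⟩
  | succ N ih =>
    rw [add_mul, one_mul] at hfar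
    -- After the last exit from the ball of radius ρ about `u`, the path stays outside. The
    -- induction therefore continues from `y` with `H` restricted to the complement of the ball,
    -- having spent at most `ρ + ℓ` of the distance.
    obtain ⟨x, y, hx, ⟨hxy, hy⟩, hyρ, hyv⟩ := exists_last_exit (fun x => dist u x ≤ ρ) huv
      (by simp [hd.self]) (by omega)
    have huy := hd.triangle u x y
    have huv' := hd.triangle u y v
    obtain ⟨T, hT, hcard, hsep, hTg⟩ := ih (fun h => H h ∧ ¬ dist u h ≤ ρ) (fun h hh => hg h hh.1)
      (u := y) ⟨hy, hyρ⟩ (Relation.ReflTransGen.mono (fun a b hab => ⟨hab.1.1, hab.1.2, hab.2⟩) _ _ hyv) (by omega)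
    have hout : ∀ t ∈ T, σ < dist (g u) t := by
      intro t ht
      obtain ⟨h, ⟨hh, hhρ⟩, rfl⟩ := hTg t ht
      have h1 := hg h hh
      have h2 := hg u hu
      have h3 := hd.triangle u (g u) h
      have h4 := hd.triangle (g u) (g h) h
      have h5 := hd.symm (g u) u
      omega
    refine ⟨insert (g u) T, ?_, ?_, ?_, ?_⟩
    · rw [chainSets, Finset.mem_biUnion]
      refine ⟨g y, ?_, Finset.mem_image_of_mem _ hT⟩
      rw [Finset.mem_filter]
      refine ⟨Finset.mem_univ _, ?_⟩
      have h1 := hg y hy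
      have h2 := hg u hu
      have h3 := hd.triangle (g u) u (g y)
      have h4 := hd.triangle u y (g y)
      have h5 := hd.symm (g y) y
      omega
    · rw [Finset.card_insert_of_notMem, hcard]
      intro hmem
      have := hout _ hmem
      rw [hd.self] at this
      omega
    · intro a ha b hb hab
      rcases Finset.mem_insert.1 ha with rfl | ha <;> rcases Finset.mem_insert.1 hb with rfl | hb
      · exact absurd rfl hab
      · exact hout b hb
      · rw [hd.symm]
        exact hout a ha
      · exact hsep a ha b hb hab
    · intro t ht
      rcases Finset.mem_insert.1 ht with rfl | ht
      · exact ⟨u, hu, rfl⟩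
      · obtain ⟨h, hh, rfl⟩ := hTg t ht
        exact ⟨h, hh.1, rfl⟩

open Classical in
/-- The partition of `H` into the components of a symmetric relation. -/
theorem exists_finpartition_components {α : Type} [DecidableEq α] (H : Finset α)
    (r : α → α → Prop) (hr : ∀ x y, r x y → r y x) :
    ∃ P : Finpartition H,
      (∀ A ∈ P.parts, ∀ u ∈ A, ∀ v ∈ A, Relation.ReflTransGen (fun x y => r x y ∧ y ∈ H) u v) ∧
      ∀ A ∈ P.parts, ∀ B ∈ P.parts, A ≠ B → ∀ u ∈ A, ∀ v ∈ B, ¬ r u v := by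
  let r' : α → α → Prop := fun x y => r x y ∧ x ∈ H ∧ y ∈ H
  let S : Setoid α := ⟨Relation.ReflTransGen r', fun _ => Relation.ReflTransGen.refl,
    fun {x y} h => by
      have : Std.Symm r' := ⟨fun x y h => ⟨hr x y h.1, h.2.2, h.2.1⟩⟩
      exact Relation.ReflTransGen.stdSymm.symm _ _ h,
    fun h h' => h.trans h'⟩
  refine ⟨Finpartition.ofSetSetoid S H, ?_, ?_⟩
  · intro A hA u hu v hv
    rw [Finpartition.ofSetSetoid_parts, Finset.mem_image] at hA
    obtain ⟨a, ha, rfl⟩ := hA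
    have h1 := (Finset.mem_filter.1 hu).2
    have h2 := (Finset.mem_filter.1 hv).2
    have h3 : Relation.ReflTransGen r' u v := S.trans' (S.symm' h1) h2
    exact Relation.ReflTransGen.mono (fun x y h => ⟨h.1, h.2.2⟩) _ _ h3
  · intro A hA B hB hAB u hu v hv huv
    rw [Finpartition.ofSetSetoid_parts, Finset.mem_image] at hA hB
    obtain ⟨a, ha, rfl⟩ := hA
    obtain ⟨b, hb, rfl⟩ := hB
    have hu' := Finset.mem_filter.1 hu
    have hv' := Finset.mem_filter.1 hv
    have huv' : S u v := Relation.ReflTransGen.single ⟨huv, hu'.1, hv'.1⟩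
    have hab : S a b := S.trans' (S.trans' hu'.2 huv') (S.symm' hv'.2)
    apply hAB
    ext x
    simp only [Finset.mem_filter]
    exact and_congr_right fun _ => ⟨fun h => S.trans' (S.symm' hab) h, fun h => S.trans' hab h⟩

end Chains

/-! ### The torus -/

section TorusGeometry

variable {d m : ℕ}

theorem torusDist_le_iff {u v : Torus d m} {B : ℕ} :
    torusDist u v ≤ B ↔ ∀ i, (u i - v i).valMinAbs.natAbs ≤ B := by
  unfold torusDist
  rw [Finset.sup_le_iff]
  simp

theorem natAbs_valMinAbs_one_le [NeZero m] : (1 : ZMod m).valMinAbs.natAbs ≤ 1 := by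
  rw [ZMod.valMinAbs_natAbs_eq_min]
  refine (min_le_left _ _).trans ?_
  rw [ZMod.val_one_eq_one_mod]
  exact Nat.mod_le _ _

theorem isGraphDist_torusDist [NeZero m] : IsGraphDist (torusGraph d m) torusDist where
  self v := by
    rw [← Nat.le_zero, torusDist_le_iff]
    simp
  symm v w := by
    unfold torusDist
    congr 1
    funext i
    rw [← neg_sub, ZMod.natAbs_valMinAbs_neg]
  triangle u v w := by
    rw [torusDist_le_iff]
    intro i
    have h1 := torusDist_le_iff.1 (le_refl (torusDist u v)) i
    have h2 := torusDist_le_iff.1 (le_refl (torusDist v w)) i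
    have h3 := ZMod.natAbs_valMinAbs_add_le (u i - v i) (v i - w i)
    rw [sub_add_sub_cancel] at h3
    have h4 := Int.natAbs_add_le (u i - v i).valMinAbs (v i - w i).valMinAbs
    omega
  adj v w h := by
    rw [torusDist_le_iff]
    intro j
    obtain ⟨-, i, rfl | rfl⟩ := h
    · rw [← ZMod.natAbs_valMinAbs_neg]
      by_cases hij : j = i
      · subst hij
        simpa using natAbs_valMinAbs_one_le
      · simp [hij]
    · by_cases hij : j = i
      · subst hij
        simpa using natAbs_valMinAbs_one_le
      · simp [hij]

theorem card_neighbours_torusGraph_le [NeZero m] (v : Torus d m) :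
    (neighbours (torusGraph d m) v).card ≤ 2 * d := by
  classical
  have : neighbours (torusGraph d m) v ⊆
      (Finset.univ.image fun i : Fin d => v + Pi.single i 1) ∪
      (Finset.univ.image fun i : Fin d => v - Pi.single i 1) := by
    intro w hw
    have hw : (torusGraph d m).Adj v w := by simpa [neighbours] using hw
    obtain ⟨-, i, h | h⟩ := hw
    · exact Finset.mem_union_left _ (Finset.mem_image.2 ⟨i, Finset.mem_univ _, h.symm⟩)
    · refine Finset.mem_union_right _ (Finset.mem_image.2 ⟨i, Finset.mem_univ _, ?_⟩)
      rw [h, add_sub_cancel_right]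
  refine (Finset.card_le_card this).trans ((Finset.card_union_le _ _).trans ?_)
  have h1 := Finset.card_image_le (s := Finset.univ) (f := fun i : Fin d => v + Pi.single i 1)
  have h2 := Finset.card_image_le (s := Finset.univ) (f := fun i : Fin d => v - Pi.single i 1)
  rw [Finset.card_univ, Fintype.card_fin] at h1 h2
  omega

open Classical in
theorem card_torus_ball_le [NeZero m] (B : ℕ) (v : Torus d m) :
    (Finset.univ.filter fun w => torusDist v w ≤ B).card ≤ (2 * B + 1) ^ d := by
  have : (Finset.univ.filter fun w => torusDist v w ≤ B) ⊆
      (Fintype.piFinset fun _ : Fin d => Finset.Icc (-B : ℤ) B).image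
        fun a i => v i - (a i : ZMod m) := by
    intro w hw
    rw [Finset.mem_filter, torusDist_le_iff] at hw
    refine Finset.mem_image.2 ⟨fun i => (v i - w i).valMinAbs, ?_, ?_⟩
    · rw [Fintype.mem_piFinset]
      intro i
      have := hw.2 i
      rw [Finset.mem_Icc]
      omega
    · funext i
      simp
  refine (Finset.card_le_card this).trans (Finset.card_image_le.trans ?_)
  rw [Fintype.card_piFinset]
  simp only [Int.card_Icc, Finset.prod_const, Finset.card_univ, Fintype.card_fin]
  apply le_of_eq
  congr 1
  omega

theorem card_torus [NeZero m] : Fintype.card (Torus d m) = m ^ d := by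
  simp [ZMod.card]

/-- If every point of `H` is within distance `r` of a marked point, and there are neither many
separated marked points nor long chains of separated marked points, then `H` is sparse. -/
theorem isSparse_of_no_chain [NeZero m] {n : ℕ} (H : Finset (Torus d m))
    (g : Torus d m → Torus d m) (r σ ℓ N L : ℕ) (hg : ∀ h ∈ H, torusDist (g h) h ≤ r)
    (hℓ : 2 * (d : ℝ) * Real.log n ^ 4 ≤ ℓ)
    (hσ : (σ : ℝ) + 2 * r < 2 * (d : ℝ) * Real.log n ^ 4)
    (hN : (N : ℝ) * ((σ : ℝ) + 2 * r + ℓ) ≤ Real.log n ^ 5)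
    (hL : (L : ℝ) ≤ ((n : ℝ) / Real.log n ^ 7) ^ d + 1)
    (hmany : ¬ ∃ T : Finset (Torus d m), T.card = L ∧ Separated torusDist σ T ∧
      ∀ t ∈ T, ∃ h ∈ H, g h = t)
    (hchain : ¬ ∃ u, ∃ T ∈ chainSets torusDist (σ + 2 * r + ℓ + 2 * r) N u,
      T.card = N + 1 ∧ Separated torusDist σ T ∧ ∀ t ∈ T, ∃ h ∈ H, g h = t) :
    IsSparse n H := by
  classical
  have hd : IsGraphDist (torusGraph d m) torusDist := isGraphDist_torusDist
  -- Components of the relation "closer than the sparsity threshold" satisfy the separation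
  -- requirement automatically; their number and diameters remain to be bounded.
  obtain ⟨P, hP1, hP2⟩ := exists_finpartition_components H
    (fun x y => (torusDist x y : ℝ) < 2 * (d : ℝ) * Real.log n ^ 4)
    (fun x y h => by rwa [hd.symm])
  refine ⟨P, ?_, ?_, fun A hA B hB hAB u hu v hv => not_lt.1 (hP2 A hA B hB hAB u hu v hv)⟩
  · by_contra hcard
    rw [not_le] at hcard
    have hLP : L ≤ P.parts.card := by
      by_contra hlt
      have : (P.parts.card : ℝ) + 1 ≤ L := by exact_mod_cast not_le.1 hlt
      linarith
    obtain ⟨Q, hQP, hQ⟩ := Finset.exists_subset_card_eq hLP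
    have hne : ∀ A ∈ P.parts, A.Nonempty := fun A hA => P.nonempty_of_mem_parts hA
    let f : Finset (Torus d m) → Torus d m := fun A => if h : A.Nonempty then h.choose else 0
    have hf : ∀ A ∈ P.parts, f A ∈ A := by
      intro A hA
      simp only [f, dif_pos (hne A hA)]
      exact (hne A hA).choose_spec
    have hfH : ∀ A ∈ P.parts, f A ∈ H := fun A hA => P.le hA (hf A hA)
    -- One point per component: moving both points by at most `r` leaves them more than σ apart.
    have hsep : ∀ A ∈ Q, ∀ B ∈ Q, A ≠ B → σ < torusDist (g (f A)) (g (f B)) := by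
      intro A hA B hB hAB
      have h1 := not_lt.1 (hP2 A (hQP hA) B (hQP hB) hAB _ (hf A (hQP hA)) _ (hf B (hQP hB)))
      have h2 : (σ : ℝ) + 2 * r < (torusDist (f A) (f B) : ℝ) := hσ.trans_le h1
      have h2 : σ + 2 * r < torusDist (f A) (f B) := by exact_mod_cast h2
      have h3 := hg _ (hfH A (hQP hA))
      have h4 := hg _ (hfH B (hQP hB))
      have h5 := hd.triangle (f A) (g (f A)) (f B)
      have h6 := hd.triangle (g (f A)) (g (f B)) (f B)
      have h7 := hd.symm (g (f A)) (f A)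
      omega
    refine hmany ⟨Q.image fun A => g (f A), ?_, ?_, ?_⟩
    · rw [Finset.card_image_of_injOn, hQ]
      intro A hA B hB hAB
      by_contra hne
      have := hsep A hA B hB hne
      rw [show g (f A) = g (f B) from hAB, hd.self] at this
      omega
    · intro a ha b hb hab
      obtain ⟨A, hA, rfl⟩ := Finset.mem_image.1 ha
      obtain ⟨B, hB, rfl⟩ := Finset.mem_image.1 hb
      exact hsep A hA B hB fun h => hab (by rw [h])
    · intro t ht
      obtain ⟨A, hA, rfl⟩ := Finset.mem_image.1 ht
      exact ⟨f A, hfH A (hQP hA), rfl⟩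
  · intro A hA u hu v hv
    by_contra hfar
    rw [not_le] at hfar
    have hfar' : N * (σ + 2 * r + ℓ) < torusDist u v := by
      have := hN.trans_lt hfar
      exact_mod_cast this
    obtain ⟨T, hT, h1, h2, h3⟩ := exists_chain hd g r ℓ (σ + 2 * r) σ N le_rfl (fun h => h ∈ H)
      hg (P.le hA hu) (Relation.ReflTransGen.mono (fun x y hxy =>
        ⟨by exact_mod_cast (hxy.1.le.trans hℓ), hxy.2⟩) _ _ (hP1 A hA u hu v hv)) hfar'
    exact hchain ⟨_, T, hT, h1, h2, h3⟩

open Classical in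
/-- The probability that the full history is not sparse. -/
theorem percolations_not_isSparse_le [NeZero m] {n : ℕ} (β : ℝ≥0) (s r ℓ N L : ℕ)
    (hℓ : 2 * (d : ℝ) * Real.log n ^ 4 ≤ ℓ)
    (hσ : 2 * (s : ℝ) + 2 * r < 2 * (d : ℝ) * Real.log n ^ 4)
    (hN : (N : ℝ) * (2 * (s : ℝ) + 2 * r + ℓ) ≤ Real.log n ^ 5)
    (hL : (L : ℝ) ≤ ((n : ℝ) / Real.log n ^ 7) ^ d + 1) :
    (percolations (torusGraph d m) β s).toOuterMeasure
        {η | ¬ IsSparse n (history η s (Finset.univ : Finset (Torus d m)))}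
      ≤ ((m ^ d : ℕ) : ℝ≥0∞) * (6 * d * ENNReal.ofReal (edgeProb β)) ^ r
        + ((m ^ d).choose L : ℕ) * ((6 * d * ENNReal.ofReal (edgeProb β)) ^ s) ^ L
        + ((m ^ d * ((2 * (2 * s + 4 * r + ℓ) + 1) ^ d) ^ N : ℕ) : ℝ≥0∞) *
          ((6 * d * ENNReal.ofReal (edgeProb β)) ^ s) ^ (N + 1) := by
  have hd : IsGraphDist (torusGraph d m) torusDist := isGraphDist_torusDist
  set G := torusGraph d m
  have hz : (6 * d * ENNReal.ofReal (edgeProb β) : ℝ≥0∞)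
      = 3 * ((2 * d : ℕ) : ℝ≥0∞) * ENNReal.ofReal (edgeProb β) := by
    push_cast
    ring
  have bound := percolations_exists_hasOpenPath_le hd (card_neighbours_torusGraph_le (d := d)) β
  rw [← hz] at bound
  set B := 2 * s + 2 * r + ℓ + 2 * r
  let 𝓣₁ : Finset (Finset (Torus d m)) := Finset.univ.image fun v => {v}
  let 𝓣₂ : Finset (Finset (Torus d m)) := Finset.univ.powersetCard L
  let 𝓣₃ : Finset (Finset (Torus d m)) := Finset.univ.biUnion fun v => chainSets torusDist B N v
  let bad : ℕ → ℕ → Finset (Finset (Torus d m)) → Set (ℕ → Finset (Sym2 (Torus d m))) :=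
    fun M L 𝓣 => {η | ∃ T ∈ 𝓣, T.card = L ∧ Separated torusDist (2 * M) T ∧
      ∀ v ∈ T, HasOpenPath G M s v η}
  -- Restricting to the support ensures that all open edges are edges of the torus.
  have hsub : {η | ¬ IsSparse n (history η s (Finset.univ : Finset (Torus d m)))} ∩
      (percolations G β s).support ⊆ bad r 1 𝓣₁ ∪ bad s L 𝓣₂ ∪ bad s (N + 1) 𝓣₃ := by
    rintro η ⟨hη, hsupp⟩
    by_contra hbad
    rw [Set.mem_union, Set.mem_union, not_or, not_or] at hbad
    obtain ⟨⟨h1, h2⟩, h3⟩ := hbad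
    refine hη ?_
    set H := history η s (Finset.univ : Finset (Torus d m))
    -- `g h` is an ancestor of `h` with a path of `s` edges; if it were farther than `r`, it would
    -- start a path of `r` edges, which the first bad event excludes.
    have hex : ∀ h, ∃ v, h ∈ H → HasOpenPath G s s v η ∧ torusDist v h ≤ r := by
      intro h
      by_cases hh : h ∈ H
      · obtain ⟨v, -, hv, hvR⟩ := exists_hasOpenPath_of_mem_history hd η
          (subset_allEdges_of_mem_support hsupp) hh
        refine ⟨v, fun _ => ⟨hv, ?_⟩⟩
        by_contra hlt
        refine h1 ⟨{v}, Finset.mem_image_of_mem _ (Finset.mem_univ v), by simp, ?_, ?_⟩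
        · intro a ha b hb hab
          rw [Finset.mem_singleton] at ha hb
          exact absurd (ha.trans hb.symm) hab
        · intro a ha
          rw [Finset.mem_singleton.1 ha]
          exact hvR r (by omega)
      · exact ⟨h, fun h' => absurd h' hh⟩
    choose g hg using hex
    refine isSparse_of_no_chain H g r (2 * s) ℓ N L (fun h hh => (hg h hh).2) hℓ
      (by push_cast; exact hσ) (by push_cast; exact hN) hL ?_ ?_
    · rintro ⟨T, hT, hsep, hTg⟩
      refine h2 ⟨T, Finset.mem_powersetCard.2 ⟨Finset.subset_univ _, hT⟩, hT, hsep, ?_⟩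
      intro v hv
      obtain ⟨h, hh, rfl⟩ := hTg v hv
      exact (hg h hh).1
    · rintro ⟨u, T, hTu, hT, hsep, hTg⟩
      refine h3 ⟨T, Finset.mem_biUnion.2 ⟨u, Finset.mem_univ _, hTu⟩, hT, hsep, ?_⟩
      intro v hv
      obtain ⟨h, hh, rfl⟩ := hTg v hv
      exact (hg h hh).1
  refine (PMF.toOuterMeasure_mono _ hsub).trans ?_
  refine (MeasureTheory.measure_union_le _ _).trans ?_
  refine add_le_add ((MeasureTheory.measure_union_le _ _).trans (add_le_add ?_ ?_)) ?_
  · refine (bound r s s 1 𝓣₁).trans ?_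
    rw [pow_one]
    gcongr
    refine Finset.card_image_le.trans ?_
    rw [Finset.card_univ, card_torus]
  · refine (bound s s s L 𝓣₂).trans ?_
    gcongr
    rw [Finset.card_powersetCard, Finset.card_univ, card_torus]
  · refine (bound s s s (N + 1) 𝓣₃).trans ?_
    gcongr
    refine (Finset.card_biUnion_le_card_mul _ _ _ fun v _ =>
      card_chainSets_le (card_torus_ball_le B) N v).trans ?_
    rw [Finset.card_univ, card_torus]
    apply le_of_eq
    congr 4
    simp only [B]
    ring

end TorusGeometry

/-! ### Asymptotic estimates -/

section Estimates

/-- The survival probability after `s ≥ 11 d p_⋆ log log n` steps, with `k = log n`. -/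
theorem pow_le_of_pStar_le {d s : ℕ} (hd : 1 ≤ d) {p k : ℝ} (hp : 0 < p)
    (hp1 : 4 * Real.exp 1 * d * p < 1) (hk : 1 ≤ k)
    (hs : 11 * (d : ℝ) * pStar d p * Real.log k ≤ s) :
    (6 * d * p) ^ s ≤ (k ^ (11 * d))⁻¹ := by
  have hd' : (1 : ℝ) ≤ d := by exact_mod_cast hd
  set a := 4 * Real.exp 1 * d * p with ha
  have ha0 : 0 < a := by positivity
  have hza : 6 * d * p ≤ a := by
    rw [ha]
    have h1 := Real.exp_one_gt_d9
    have h2 : 0 ≤ d * p := by positivity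
    nlinarith
  have hlog : 0 < Real.log (1 / a) := Real.log_pos (by rwa [lt_div_iff₀ ha0, one_mul])
  have hs' : 11 * d * Real.log k ≤ s * Real.log (1 / a) := by
    unfold pStar at hs
    rw [← ha, mul_one_div, div_mul_eq_mul_div, div_le_iff₀ hlog] at hs
    exact hs
  calc (6 * d * p) ^ s ≤ a ^ s := by gcongr
    _ = Real.exp (-(s * Real.log (1 / a))) := by
        rw [one_div, Real.log_inv, mul_neg, neg_neg, Real.exp_nat_mul, Real.exp_log ha0]
    _ ≤ Real.exp (-(11 * d * Real.log k)) := by gcongr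
    _ = (k ^ (11 * d))⁻¹ := by
        rw [Real.exp_neg, show 11 * (d : ℝ) * Real.log k = ((11 * d : ℕ) : ℝ) * Real.log k by
          push_cast; ring, Real.exp_nat_mul, Real.exp_log (by linarith)]

theorem exp_neg_eq_inv_pow {n : ℕ} (hn : 0 < n) (j : ℕ) :
    Real.exp (-(j * Real.log n)) = ((n : ℝ) ^ j)⁻¹ := by
  rw [Real.exp_neg, Real.exp_nat_mul, Real.exp_log (by exact_mod_cast hn)]

/-- The choice of a starting vertex costs `n^d`, which turns `n^(-11d)` into `n^(-10d)`. -/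
theorem mul_exp_neg_le {n d : ℕ} (hn : 0 < n) {M : ℝ} (hM : M ≤ (n : ℝ) ^ d) :
    M * Real.exp (-(11 * d * Real.log n)) ≤ ((n : ℝ) ^ (10 * d))⁻¹ := by
  have hn' : (0 : ℝ) < n := by exact_mod_cast hn
  calc M * Real.exp (-(11 * d * Real.log n))
      ≤ (n : ℝ) ^ d * Real.exp (-(11 * d * Real.log n)) := by gcongr
    _ = (n : ℝ) ^ d * ((n : ℝ) ^ (11 * d))⁻¹ := by
        rw [← exp_neg_eq_inv_pow hn (11 * d)]
        push_cast
        rfl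
    _ = ((n : ℝ) ^ (10 * d))⁻¹ := by
        rw [show 11 * d = d + 10 * d by ring, pow_add, mul_inv, ← mul_assoc,
          mul_inv_cancel₀ (by positivity), one_mul]

theorem long_path_bound {n d r : ℕ} (hn : 0 < n) {M z : ℝ} (hM0 : 0 ≤ M) (hM : M ≤ (n : ℝ) ^ d)
    (hz0 : 0 ≤ z) (hz : z ≤ Real.exp (-1)) (hr : 11 * d * Real.log n ≤ r) :
    M * z ^ r ≤ ((n : ℝ) ^ (10 * d))⁻¹ := by
  refine le_trans ?_ (mul_exp_neg_le hn hM)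
  gcongr
  calc z ^ r ≤ Real.exp (-1) ^ r := by gcongr
    _ = Real.exp (-r) := by rw [← Real.exp_nat_mul, mul_neg_one]
    _ ≤ _ := by gcongr

/-- Uses `L^L / L! ≤ e^L`. -/
theorem choose_mul_pow_le {M L : ℕ} (hL : 0 < L) {y : ℝ} (hy : 0 ≤ y) :
    (M.choose L : ℝ) * y ^ L ≤ (Real.exp 1 * M / L * y) ^ L := by
  have hL' : (0 : ℝ) < L := by exact_mod_cast hL
  have h1 : (M.choose L : ℝ) ≤ (M : ℝ) ^ L / L.factorial := Nat.choose_le_pow_div L M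
  have h2 := Real.pow_div_factorial_le_exp (x := (L : ℝ)) hL'.le L
  rw [mul_pow]
  gcongr
  calc (M.choose L : ℝ) ≤ (M : ℝ) ^ L / L.factorial := h1
    _ = ((M : ℝ) / L) ^ L * ((L : ℝ) ^ L / L.factorial) := by
        rw [div_pow]
        field_simp
    _ ≤ ((M : ℝ) / L) ^ L * Real.exp L := by gcongr
    _ = (Real.exp 1 * M / L) ^ L := by
        rw [← Real.exp_one_pow L, ← mul_pow]
        ring

/-- Here `M / L ≤ k^(7d)` against `y ≤ k^(-11d)` leaves `k^(-4d)`, enough to push the base below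
`1/e`; then `L ≥ 10dk` suffices. -/
theorem many_survivors_bound {n d M L : ℕ} (hd : 1 ≤ d) (hn : 0 < n) {k y : ℝ}
    (hk : k = Real.log n) (hk3 : 3 ≤ k) (hM : (M : ℝ) ≤ (n : ℝ) ^ d) (hy0 : 0 ≤ y)
    (hy : y ≤ (k ^ (11 * d))⁻¹) (hnk : 10 * d * k ^ 8 ≤ n) (hL : ((n : ℝ) / k ^ 7) ^ d ≤ L) :
    (M.choose L : ℝ) * y ^ L ≤ ((n : ℝ) ^ (10 * d))⁻¹ := by
  have hd' : (1 : ℝ) ≤ d := by exact_mod_cast hd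
  have hn' : (0 : ℝ) < n := by exact_mod_cast hn
  have hk0 : 0 < k := by linarith
  have h10 : 10 * d * k ≤ (n : ℝ) / k ^ 7 := by
    rw [le_div_iff₀ (by positivity)]
    calc 10 * (d : ℝ) * k * k ^ 7 = 10 * d * k ^ 8 := by ring
      _ ≤ (n : ℝ) := hnk
  have hone : 1 ≤ (n : ℝ) / k ^ 7 := by nlinarith
  have hLk : 10 * d * k ≤ L := h10.trans ((le_self_pow₀ hone (by omega)).trans hL)
  have hL0 : (0 : ℝ) < L := lt_of_lt_of_le (by positivity) hLk
  refine (choose_mul_pow_le (by exact_mod_cast hL0) hy0).trans ?_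
  have hbase : Real.exp 1 * M / L * y ≤ Real.exp (-1) := by
    have hML : (M : ℝ) / L ≤ k ^ (7 * d) := by
      rw [div_le_iff₀ hL0]
      calc (M : ℝ) ≤ (n : ℝ) ^ d := hM
        _ = k ^ (7 * d) * ((n : ℝ) / k ^ 7) ^ d := by
            rw [div_pow, ← pow_mul]
            field_simp
        _ ≤ _ := by gcongr
    have hk4 : Real.exp 1 * Real.exp 1 ≤ k ^ (4 * d) := by
      have h1 := Real.exp_one_lt_d9
      have h2 := Real.exp_pos 1
      calc Real.exp 1 * Real.exp 1 ≤ 3 ^ 4 := by nlinarith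
        _ ≤ k ^ 4 := by gcongr
        _ ≤ k ^ (4 * d) := pow_le_pow_right₀ (by linarith) (by omega)
    calc Real.exp 1 * M / L * y = Real.exp 1 * (M / L) * y := by ring
      _ ≤ Real.exp 1 * k ^ (7 * d) * (k ^ (11 * d))⁻¹ := by gcongr
      _ = Real.exp 1 * (k ^ (4 * d))⁻¹ := by
          rw [show 11 * d = 7 * d + 4 * d by ring, pow_add]
          field_simp
      _ ≤ Real.exp 1 * (Real.exp 1 * Real.exp 1)⁻¹ := by gcongr
      _ = Real.exp (-1) := by
          rw [Real.exp_neg, mul_inv, ← mul_assoc, mul_inv_cancel₀ (Real.exp_pos 1).ne', one_mul]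
  calc _ ≤ Real.exp (-1) ^ L := by gcongr
    _ = Real.exp (-L) := by rw [← Real.exp_nat_mul, mul_neg_one]
    _ ≤ Real.exp (-((10 * d : ℕ) * Real.log n)) := by
        rw [← hk]
        gcongr
        push_cast
        exact hLk
    _ = _ := exp_neg_eq_inv_pow hn _

/-- Each link has at most `k^(5d)` choices and costs `k^(-11d)`, a gain of `k^(-6d)`. Over `N + 1 ≥
k/(4d)` links with `log k ≥ 8d` the exponent is at least `12dk`, more than the `11dk` required. -/
theorem chain_bound {n d N B : ℕ} (hn : 0 < n) {k y M : ℝ} (hk : k = Real.log n)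
    (hk1 : 1 ≤ k) (hlk : 8 * d ≤ Real.log k) (hM0 : 0 ≤ M) (hM : M ≤ (n : ℝ) ^ d) (hy0 : 0 ≤ y)
    (hy : y ≤ (k ^ (11 * d))⁻¹) (hB : (B : ℝ) ≤ k ^ 5) (hN : k ≤ 4 * d * ((N : ℝ) + 1)) :
    M * ((B : ℝ) ^ d) ^ N * y ^ (N + 1) ≤ ((n : ℝ) ^ (10 * d))⁻¹ := by
  have hk0 : 0 < k := by linarith
  refine le_trans ?_ (mul_exp_neg_le hn hM)
  rw [mul_assoc]
  gcongr
  calc ((B : ℝ) ^ d) ^ N * y ^ (N + 1)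
      ≤ ((k ^ 5) ^ d) ^ (N + 1) * ((k ^ (11 * d))⁻¹) ^ (N + 1) := by
        gcongr
        calc ((B : ℝ) ^ d) ^ N ≤ ((k ^ 5) ^ d) ^ N := by gcongr
          _ ≤ _ := pow_le_pow_right₀ (one_le_pow₀ (one_le_pow₀ hk1)) (Nat.le_succ N)
    _ = ((k ^ (6 * d))⁻¹) ^ (N + 1) := by
        rw [← mul_pow]
        congr 1
        rw [← pow_mul, show 11 * d = 5 * d + 6 * d by ring, pow_add]
        field_simp
    _ = Real.exp (-(((6 * d * (N + 1) : ℕ) : ℝ) * Real.log k)) := by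
        rw [Real.exp_neg, Real.exp_nat_mul, Real.exp_log hk0, pow_mul _ (6 * d), inv_pow]
    _ ≤ Real.exp (-(11 * d * Real.log n)) := by
        rw [← hk]
        refine Real.exp_le_exp.2 (neg_le_neg ?_)
        push_cast
        have h1 : 0 ≤ Real.log k := Real.log_nonneg hk1
        have h2 : k * (8 * d) ≤ 4 * d * ((N : ℝ) + 1) * Real.log k := by gcongr
        nlinarith

/-- What is needed of a large `n`. -/
theorem eventually_large (d : ℕ) : ∃ n₀ : ℕ, ∀ n : ℕ, n₀ ≤ n → 0 < n ∧
    11 * (d : ℝ) + 4 ≤ Real.log n ∧ 8 * (d : ℝ) ≤ Real.log (Real.log n) ∧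
    10 * d * Real.log n ^ 8 ≤ n := by
  have hlog : Filter.Tendsto (fun n : ℕ => Real.log n) Filter.atTop Filter.atTop :=
    Real.tendsto_log_atTop.comp tendsto_natCast_atTop_atTop
  have h1 := hlog.eventually_ge_atTop (11 * (d : ℝ) + 4)
  have h2 := (Real.tendsto_log_atTop.comp hlog).eventually_ge_atTop (8 * (d : ℝ))
  have h3 : ∀ᶠ n : ℕ in Filter.atTop, 10 * d * Real.log n ^ 8 ≤ (n : ℝ) := by
    have hc : (0 : ℝ) < 1 / (10 * d + 1) := by positivity
    have := ((Real.isLittleO_pow_log_id_atTop (n := 8)).def hc)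
    filter_upwards [tendsto_natCast_atTop_atTop.eventually this] with n hn
    have h0 : 0 ≤ Real.log n ^ 8 := by positivity
    rw [id, Real.norm_of_nonneg h0, Real.norm_of_nonneg (Nat.cast_nonneg n), one_div,
      inv_mul_eq_div, le_div_iff₀ (by positivity)] at hn
    linarith
  obtain ⟨n₀, h⟩ := Filter.eventually_atTop.1
    (((h1.and h2).and h3).and (Filter.eventually_gt_atTop 0))
  exact ⟨n₀, fun n hn => ⟨(h n hn).2, (h n hn).1.1.1, (h n hn).1.1.2, (h n hn).1.2⟩⟩

theorem natCast_mul_ofReal {c : ℕ} {x : ℝ} : (c : ℝ≥0∞) * ENNReal.ofReal x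
    = ENNReal.ofReal (c * x) := by
  rw [ENNReal.ofReal_mul (Nat.cast_nonneg c), ENNReal.ofReal_natCast]

open Classical in
theorem percolations_not_isSparse_le_inv {d n m s : ℕ} [NeZero m] (hd : 1 ≤ d) (β : ℝ≥0)
    (hβ : 0 < edgeProb β) (hβ' : edgeProb β < 1 / (100 * d)) (hn : 0 < n) (hmn : m ≤ n)
    (h1 : 11 * (d : ℝ) + 4 ≤ Real.log n) (h2 : 8 * (d : ℝ) ≤ Real.log (Real.log n))
    (h3 : 10 * d * Real.log n ^ 8 ≤ n)
    (hs : 11 * (d : ℝ) * pStar d (edgeProb β) * Real.log (Real.log n) ≤ s)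
    (hs' : (s : ℝ) ≤ Real.log n ^ (4 / 3 : ℝ)) :
    (percolations (torusGraph d m) β s).toOuterMeasure
        {η | ¬ IsSparse n (history η s (Finset.univ : Finset (Torus d m)))}
      ≤ ENNReal.ofReal (3 * ((n : ℝ) ^ (10 * d))⁻¹) := by
  have hd' : (1 : ℝ) ≤ d := by exact_mod_cast hd
  set p := edgeProb β
  set k := Real.log n with hk
  have hk15 : 15 ≤ k := by linarith
  have hk0 : 0 < k := by linarith
  have hdp : d * p < 1 / 100 := by
    rw [lt_div_iff₀ (by positivity)] at hβ'
    linarith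
  have hz0 : 0 ≤ 6 * d * p := by positivity
  have hz : 6 * d * p ≤ Real.exp (-1) := by
    have := Real.exp_neg_one_gt_d9
    linarith
  have ha : 4 * Real.exp 1 * d * p < 1 := by
    have := Real.exp_one_lt_d9
    have : 0 < d * p := by positivity
    nlinarith
  have hy := pow_le_of_pStar_le hd hβ ha (by linarith) hs
  have hy0 : 0 ≤ (6 * d * p) ^ s := by positivity
  have hs2 : (s : ℝ) ≤ k ^ 2 := by
    refine hs'.trans ?_
    rw [← Real.rpow_natCast k 2]
    exact Real.rpow_le_rpow_of_exponent_le (by linarith) (by norm_num)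
  have hk2 : 15 * k ≤ k ^ 2 := by
    rw [sq]
    gcongr
  have hk4 : 225 * k ^ 2 ≤ k ^ 4 := by
    rw [show k ^ 4 = k ^ 2 * k ^ 2 by ring]
    gcongr
    linarith
  have hdk : 11 * d * k ≤ k ^ 2 := by
    rw [sq]
    gcongr
    linarith
  have hdk4 : k ^ 4 ≤ d * k ^ 4 := le_mul_of_one_le_left (by positivity) hd'
  have hM : ((m ^ d : ℕ) : ℝ) ≤ (n : ℝ) ^ d := by
    push_cast
    gcongr
  -- `r` exceeds `11dk` yet is negligible against `k^4`; `ℓ` is the separation threshold of sparse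
  -- sets; `N` links of length below `4dk^4` fit into the diameter `k^5`; `L` is just above the
  -- permitted number of components.
  set r := ⌈k ^ 2⌉₊
  set ℓ := ⌈2 * d * k ^ 4⌉₊
  set N := ⌊k / (4 * d)⌋₊
  set L := ⌊((n : ℝ) / k ^ 7) ^ d⌋₊ + 1
  have hr : k ^ 2 ≤ r := Nat.le_ceil _
  have hr' : (r : ℝ) < k ^ 2 + 1 := Nat.ceil_lt_add_one (by positivity)
  have hℓ : 2 * d * k ^ 4 ≤ ℓ := Nat.le_ceil _
  have hℓ' : (ℓ : ℝ) < 2 * d * k ^ 4 + 1 := Nat.ceil_lt_add_one (by positivity)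
  have hN : (N : ℝ) ≤ k / (4 * d) := Nat.floor_le (by positivity)
  have hN' : k / (4 * d) < (N : ℝ) + 1 := Nat.lt_floor_add_one _
  have hL : (L : ℝ) ≤ ((n : ℝ) / k ^ 7) ^ d + 1 := by
    push_cast [L]
    gcongr
    exact Nat.floor_le (by positivity)
  have hL' : ((n : ℝ) / k ^ 7) ^ d ≤ L := by
    push_cast [L]
    exact (Nat.lt_floor_add_one _).le
  have hNk : (N : ℝ) * (2 * (s : ℝ) + 2 * r + ℓ) ≤ k ^ 5 := by
    calc (N : ℝ) * (2 * (s : ℝ) + 2 * r + ℓ) ≤ k / (4 * d) * (4 * d * k ^ 4) := by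
          gcongr
          linarith
      _ = k ^ 5 := by field_simp
  have hB : ((2 * (2 * s + 4 * r + ℓ) + 1 : ℕ) : ℝ) ≤ k ^ 5 := by
    push_cast
    have : 5 * d * k ^ 4 ≤ k ^ 5 := by
      rw [pow_succ k 4, mul_comm]
      gcongr
      linarith
    linarith
  refine (percolations_not_isSparse_le β s r ℓ N L hℓ (by linarith) hNk hL).trans ?_
  have hzE : (6 * d * ENNReal.ofReal p : ℝ≥0∞) = ENNReal.ofReal (6 * d * p) := by
    rw [ENNReal.ofReal_mul (by positivity), ENNReal.ofReal_mul (by positivity),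
      ENNReal.ofReal_natCast]
    norm_num
  rw [hzE, ← ENNReal.ofReal_pow hz0, ← ENNReal.ofReal_pow hz0, ← ENNReal.ofReal_pow hy0,
    ← ENNReal.ofReal_pow hy0, natCast_mul_ofReal, natCast_mul_ofReal, natCast_mul_ofReal,
    ← ENNReal.ofReal_add (by positivity) (by positivity),
    ← ENNReal.ofReal_add (by positivity) (by positivity)]
  refine ENNReal.ofReal_le_ofReal ?_
  have t1 := long_path_bound hn (Nat.cast_nonneg (m ^ d)) hM hz0 hz (r := r) (by linarith)
  have t2 := many_survivors_bound hd hn hk (by linarith) hM hy0 hy h3 hL'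
  have t3 := chain_bound (N := N) hn hk (by linarith) h2 (Nat.cast_nonneg (m ^ d)) hM hy0 hy hB (by
    rw [div_lt_iff₀ (by positivity)] at hN'
    linarith)
  push_cast at t1 t2 t3 ⊢
  linarith

end Estimates

/-! ### The main theorem -/

theorem isSparse_empty (n d m : ℕ) : IsSparse n (∅ : Finset (Torus d m)) := by
  refine ⟨Finpartition.empty _, ?_, ?_, ?_⟩
  · have := Real.log_natCast_nonneg n
    simp only [Finpartition.empty_parts, Finset.card_empty, Nat.cast_zero]
    positivity
  · intro A hA
    simp at hA
  · intro A hA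
    simp at hA

open Classical in
/-- A set that is sparse is kept, any other one is replaced by the empty set. -/
def toSparse (n : ℕ) {d m : ℕ} (Δ : Finset (Torus d m)) : SparseSet n d m :=
  if h : IsSparse n Δ then ⟨Δ, h⟩ else ⟨∅, isSparse_empty n d m⟩

open Classical in
-- Only the non-sparse mass is moved, and `f` takes values in `[0, 1]`, so the loss is at most the
-- probability of not being sparse.
theorem sum_mul_le_sum_map_toSparse {n d m : ℕ} [NeZero m] (P : PMF (Finset (Torus d m)))
    (f : Finset (Torus d m) → ℝ) (hf0 : ∀ Δ, 0 ≤ f Δ) (hf1 : ∀ Δ, f Δ ≤ 1) {ε : ℝ} (hε : 0 ≤ ε)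
    (hP : P.toOuterMeasure {Δ | ¬ IsSparse n Δ} ≤ ENNReal.ofReal ε) :
    ∑ Δ, (P Δ).toReal * f Δ ≤
      ∑ Δ : SparseSet n d m, ((P.map (toSparse n)) Δ).toReal * f Δ.1 + ε := by
  have hmap : ∑ Δ : SparseSet n d m, ((P.map (toSparse n)) Δ).toReal * f Δ.1
      = ∑ Δ, (P Δ).toReal * f (toSparse n Δ).1 := by
    have : P.map (toSparse n) = P.bind fun Δ => PMF.pure (toSparse n Δ) := rfl
    simp_rw [this, toReal_bind_apply, Finset.sum_mul]
    rw [Finset.sum_comm]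
    refine Finset.sum_congr rfl fun Δ _ => ?_
    rw [Finset.sum_eq_single (toSparse n Δ)]
    · simp
    · intro S _ hS
      rw [PMF.pure_apply_of_ne _ _ hS]; simp
    · simp
  have hbad : ∑ Δ, (P Δ).toReal * (if IsSparse n Δ then 0 else 1) ≤ ε := by
    have h1 := ENNReal.toReal_mono ENNReal.ofReal_ne_top hP
    rw [ENNReal.toReal_ofReal hε, PMF.toOuterMeasure_apply, tsum_fintype, ENNReal.toReal_sum] at h1
    · refine le_trans (le_of_eq (Finset.sum_congr rfl fun Δ _ => ?_)) h1
      by_cases h : IsSparse n Δ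
      · simp [h]
      · simp [h]
    · intro Δ _
      exact ne_top_of_le_ne_top (PMF.apply_ne_top P Δ) (Set.indicator_le_self _ _ _)
  rw [hmap]
  refine le_trans ?_ (add_le_add_right hbad _)
  rw [← Finset.sum_add_distrib]
  refine Finset.sum_le_sum fun Δ _ => ?_
  rw [← mul_add]
  refine mul_le_mul_of_nonneg_left ?_ ENNReal.toReal_nonneg
  by_cases h : IsSparse n Δ
  · simp [toSparse, h]
  · rw [if_neg h]
    linarith [hf1 Δ, hf0 (toSparse n Δ).1]

end SwendsenWang

end

open SwendsenWang in
theorem mainTheorem10 (d : ℕ) (hd : 1 ≤ d) :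
    ∃ p₀ : ℝ, 0 < p₀ ∧ 4 * Real.exp 1 * d * p₀ ≤ 1 ∧
      ∀ (q : ℕ) [NeZero q], 2 ≤ q →
      ∀ β : NNReal, 0 < β → SwendsenWang.edgeProb β < p₀ →
      ∃ n₀ : ℕ, ∀ n : ℕ, n₀ ≤ n →
      ∀ (m : ℕ) [NeZero m], Real.log n ^ 5 ≤ (m : ℝ) → m ≤ n →
      ∀ s t : ℕ,
        11 * (d : ℝ) * SwendsenWang.pStar d (SwendsenWang.edgeProb β) * Real.log (Real.log n)
          ≤ (s : ℝ) →
        (s : ℝ) ≤ Real.log n ^ (4 / 3 : ℝ) →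
        0 < t →
      ∃ ρ : PMF (SwendsenWang.SparseSet n d m),
        ∀ x₀ : SwendsenWang.Torus d m → Fin q,
          SwendsenWang.tv
              (SwendsenWang.law (SwendsenWang.torusGraph d m) β x₀ (t + s))
              (SwendsenWang.potts (SwendsenWang.torusGraph d m) β)
            ≤ (∑ Δ : SwendsenWang.SparseSet n d m, (ρ Δ).toReal *
                SwendsenWang.tv
                  (SwendsenWang.proj Δ.1
                    (SwendsenWang.law (SwendsenWang.torusGraph d m) β x₀ t))
                  (SwendsenWang.proj Δ.1
                    (SwendsenWang.potts (SwendsenWang.torusGraph d m) β)))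
              + 3 * ((n : ℝ) ^ (10 * d))⁻¹ := by
  have hd' : (1 : ℝ) ≤ d := by exact_mod_cast hd
  -- This value ensures both `4edp < 1` and `6dp ≤ 1/e`.
  refine ⟨1 / (100 * d), by positivity, ?_, ?_⟩
  · have := Real.exp_one_lt_d9
    rw [mul_one_div, div_le_one (by positivity)]
    nlinarith
  intro q _ _ β hβ hβp
  obtain ⟨n₀, hn₀⟩ := eventually_large d
  refine ⟨n₀, fun n hn m _ _ hmn s t hs hs' _ => ?_⟩
  obtain ⟨hn, h1, h2, h3⟩ := hn₀ n hn
  have hβ0 : 0 < edgeProb β := by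
    have : Real.exp (-(β : ℝ)) < 1 := Real.exp_lt_one_iff.2 (neg_lt_zero.2 (by exact_mod_cast hβ))
    unfold edgeProb
    linarith
  refine ⟨(historyLaw (torusGraph d m) β s Finset.univ).map (toSparse n), fun x₀ => ?_⟩
  have hbad : (historyLaw (torusGraph d m) β s Finset.univ).toOuterMeasure {Δ | ¬ IsSparse n Δ}
      ≤ ENNReal.ofReal (3 * ((n : ℝ) ^ (10 * d))⁻¹) := by
    unfold historyLaw
    rw [PMF.toOuterMeasure_map_apply]
    exact percolations_not_isSparse_le_inv hd β hβ0 hβp hn hmn h1 h2 h3 hs hs'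
  refine le_trans ?_ (sum_mul_le_sum_map_toSparse _ (fun Δ =>
    tv (proj Δ (law (torusGraph d m) β x₀ t)) (proj Δ (potts (torusGraph d m) β)))
    (fun _ => tv_nonneg _ _) (fun _ => tv_le_one _ _) (by positivity) hbad)
  have key := tv_proj_iterate_le (torusGraph d m) β s Finset.univ (law (torusGraph d m) β x₀ t)
    (potts (torusGraph d m) β)
  -- Stationarity turns the second evolved law back into the Potts measure.
  rw [← law_add, potts_iterate] at key
  refine (tv_le_tv_proj_univ _ _).trans ?_
  exact key
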